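/- Let $M$ be a smooth 4-manifold with a smooth Lorentz metric $g$ of signature $(-,+,+,+)$, and let $k$ be a smooth nowhere vanishing null vector field on $M$ that generates a shear-free congruence of null geodesics. This means: the local flow of $k$ preserves $K^\perp=\{v: g(v,k)=0\}$ and the conformal structure which $g$ induces on $K^\perp$; or, in the equivalent formulation, $\mathcal L_k g=\lambda g+\phi\otimes g(k)$ for a function $\lambda$ and a one-form $\phi$, where $\otimes$ is the symmetric product and $g(v)$ denotes the one-form $w\mapsto g(v,w)$. (The result holds under either formulation.) Let $K$ be the real line bundle spanned by $k$. Let $U\subset M$ be open and let $\pi:U\to M'$ be a local orbit space of $k$, that is, a surjective smooth submersion onto a smooth 3-manifold $M'$ whose fibres are the orbits of $k$ in $U$. Fix an orientation of the plane bundle $K^\perp/K$ over $U$, on which $g$ induces a positive definite metric, and let $J$ be the rotation of $K^\perp/K$ by $\pi/2$. Extend $g$ complex bilinearly and put $$N=\{n\in \mathbb C\otimes K^\perp : J[n]=-i[n]\}.$$ Then: 1. $N$ is totally null and has complex rank 2. There is a family $B$ of complex subspaces of $\mathbb C\otimes TM'$ with $\pi_*(N_p)=\overline{B}_{\pi(p)}$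 for all $p\in U$. It is a smooth complex line bundle with $B\cap\overline B=\{0\}$, so that $(M',B)$ is a 3-dimensional CR manifold. 2. Let $V\subset U$ be open, let $\xi,\eta$ be smooth sections of $K^\perp$ over $V$ with $\xi\notin K$ and $J[\xi]=[\eta]$, and put $n=\xi+i\eta$ and $F=g(n)\wedge g(k)$. (Such $V,\xi,\eta$ exist near every point of $U$.) Then $N=\{v: i_vF=0\}$ over $V$. For each $p\in V$ there is exactly one complex 2-form on $T_{\pi(p)}M'$ whose pull-back by $d\pi_p$ is $F_p$; it is nonzero and lies in the fibre at $\pi(p)$ of the canonical bundle $\Omega=\{\omega\in\mathbb C\otimes\Lambda^2T^*M' : i_b\omega=0 \text{ for all } b\in\overline B\}$. 3. After $n$ is normalized along the orbits, $F$ descends to a nowhere-zero section of the canonical bundle. Precisely, let $W\subset M'$ be open and let $\sigma:W\to V$ be a smooth section of $\pi$. (Every $p\in U$ lies on the image of such a section, for a suitable $V$ as in 2.) Then there are a smooth nowhere-zero function $h:V\cap\pi^{-1}(W)\to\mathbb C$ with $h\circ\sigma=1$ and a smooth nowhere-zero section $F'$ of $\Omega$ over $W$ such that $g(hn)\wedge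 g(k)=\pi^*F'$ on $V\cap\pi^{-1}(W)$. -/

import Mathlib

open scoped Manifold ContDiff TensorProduct

noncomputable section

namespace NullCongruence

section Complexification

variable {m : ℕ} {X : Type*} [TopologicalSpace X] [ChartedSpace (EuclideanSpace ℝ (Fin m)) X]

/-- The complexified tangent space `ℂ ⊗ T_x X`. -/
abbrev CT (m : ℕ) {X : Type*} [TopologicalSpace X]
    [ChartedSpace (EuclideanSpace ℝ (Fin m)) X] (x : X) : Type :=
  ℂ ⊗[ℝ] TangentSpace (𝓡 m) x

/-- The complex tangent vector `v + i w`. -/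
def cvec {x : X} (v w : TangentSpace (𝓡 m) x) : CT m x :=
  (1 : ℂ) ⊗ₜ[ℝ] v + Complex.I ⊗ₜ[ℝ] w

/-- Complex conjugation on `ℂ ⊗ T_x X`. -/
def conj (x : X) : CT m x →ₗ[ℝ] CT m x :=
  LinearMap.rTensor (TangentSpace (𝓡 m) x) Complex.conjAe.toLinearMap

lemma conj_smul (x : X) (c : ℂ) (v : CT m x) :
    conj x (c • v) = (starRingEnd ℂ c) • conj x v := by
  induction v using TensorProduct.induction_on with
  | zero => simp
  | tmul a v => simp [conj, TensorProduct.smul_tmul']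
  | add a b ha hb => rw [smul_add, map_add, ha, hb, map_add, smul_add]

/-- The conjugate subspace `{v : conj v ∈ S}`. -/
def conjSubspace {x : X} (S : Submodule ℂ (CT m x)) : Submodule ℂ (CT m x) where
  carrier := {v | conj x v ∈ S}
  add_mem' {a b} ha hb := by
    simp only [Set.mem_ofPred_eq, map_add] at *
    exact S.add_mem ha hb
  zero_mem' := by simp
  smul_mem' c v hv := by
    simp only [Set.mem_ofPred_eq, conj_smul] at *
    exact S.smul_mem _ hv

/-- A real vector field is smooth on the set `U`. -/
def SmoothFieldOn [IsManifold (𝓡 m) ∞ X] (Y : ∀ x : X, TangentSpace (𝓡 m) x) (U : Set X) : Prop :=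
  ContMDiffOn (𝓡 m) (𝓡 m).tangent ∞ (fun x => (⟨x, Y x⟩ : TangentBundle (𝓡 m) X)) U

/-- The wedge product `(u, v) ↦ α u * β v - α v * β u` of two complex covectors. -/
def wedge {V : Type*} [AddCommGroup V] [Module ℂ V] (α β : V →ₗ[ℂ] ℂ) :
    V →ₗ[ℂ] V →ₗ[ℂ] ℂ :=
  α.smulRight β - β.smulRight α

end Complexification

section CR

variable {M' : Type*} [TopologicalSpace M'] [ChartedSpace (EuclideanSpace ℝ (Fin 3)) M']
  [IsManifold (𝓡 3) ∞ M']

/-- A CR structure on a 3-manifold: a smooth complex line subbundle `B` of `ℂ ⊗ TM'` such that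
`B ∩ conj B` is the zero section. -/
structure IsCRStructure (B : ∀ x : M', Submodule ℂ (CT 3 x)) : Prop where
  rank_one : ∀ x, Module.finrank ℂ (B x) = 1
  smooth : ∀ x, ∃ (U : Set M') (Y Z : ∀ y : M', TangentSpace (𝓡 3) y), IsOpen U ∧ x ∈ U ∧
    SmoothFieldOn Y U ∧ SmoothFieldOn Z U ∧ ∀ y ∈ U, B y = Submodule.span ℂ {cvec (Y y) (Z y)}
  disjoint : ∀ x, B x ⊓ conjSubspace (B x) = ⊥

/-- The fibre at `x` of the canonical bundle of `(M', B)`: the alternating complex 2-forms `Ω` on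
`ℂ ⊗ T_x M'` with `i_b Ω = 0` for all `b ∈ conj B`. -/
def IsCanonical (B : ∀ x : M', Submodule ℂ (CT 3 x)) (x : M')
    (Ω : CT 3 x →ₗ[ℂ] CT 3 x →ₗ[ℂ] ℂ) : Prop :=
  (∀ v, Ω v v = 0) ∧ ∀ b ∈ conjSubspace (B x), Ω b = 0

/-- `Ω` is a smooth section over the open set `W` of the canonical bundle of `(M', B)`. -/
def IsCanonicalSectionOn (B : ∀ x : M', Submodule ℂ (CT 3 x)) (W : Set M')
    (Ω : ∀ x : M', CT 3 x →ₗ[ℂ] CT 3 x →ₗ[ℂ] ℂ) : Prop :=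
  (∀ x ∈ W, IsCanonical B x (Ω x)) ∧
  ∀ (U : Set M') (Y Z : ∀ y : M', TangentSpace (𝓡 3) y), IsOpen U → U ⊆ W →
    SmoothFieldOn Y U → SmoothFieldOn Z U →
    ContMDiffOn (𝓡 3) 𝓘(ℝ, ℂ) ∞ (fun y => Ω y (cvec (Y y) 0) (cvec (Z y) 0)) U

end CR

section Lorentz

variable (M : Type*) [TopologicalSpace M] [ChartedSpace (EuclideanSpace ℝ (Fin 4)) M]
  [IsManifold (𝓡 4) ∞ M]

/-- A smooth Lorentz metric, of signature `(-,+,+,+)`, on a 4-manifold. -/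
structure LorentzMetric where
  /-- the metric at each point -/
  form : ∀ x : M, TangentSpace (𝓡 4) x →L[ℝ] TangentSpace (𝓡 4) x →L[ℝ] ℝ
  symm : ∀ x v w, form x v w = form x w v
  signature : ∀ x, ∃ e : Module.Basis (Fin 4) ℝ (TangentSpace (𝓡 4) x), ∀ i j,
    form x (e i) (e j) = if i = j then (if i = 0 then -1 else 1) else 0
  smooth : ContMDiff (𝓡 4) ((𝓡 4).prod
      𝓘(ℝ, EuclideanSpace ℝ (Fin 4) →L[ℝ] EuclideanSpace ℝ (Fin 4) →L[ℝ] ℝ)) ∞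
    (fun x => Bundle.TotalSpace.mk'
      (EuclideanSpace ℝ (Fin 4) →L[ℝ] EuclideanSpace ℝ (Fin 4) →L[ℝ] ℝ) x (form x))

variable {M}
variable (g : LorentzMetric M) (k : ∀ x : M, TangentSpace (𝓡 4) x)

/-- The hyperplane `K^⊥ = {v : g(v, k) = 0}`. -/
def Kperp (x : M) : Submodule ℝ (TangentSpace (𝓡 4) x) :=
  LinearMap.ker ((g.form x (k x)).toLinearMap)

/-- The line `K` spanned by `k`, as a subspace of `K^⊥`. -/
def Kline (x : M) : Submodule ℝ (Kperp g k x) :=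
  (Submodule.span ℝ {k x}).comap (Kperp g k x).subtype

/-- The quotient `K^⊥ / K`. -/
abbrev Screen (x : M) : Type := Kperp g k x ⧸ Kline g k x

/-- The projection `K^⊥ → K^⊥ / K`, `n ↦ [n]`. -/
def toScreen (x : M) : Kperp g k x →ₗ[ℝ] Screen g k x := (Kline g k x).mkQ

/-- `ξ, η` are smooth sections over `V` of `K^⊥` with `ξ ∉ K` and `J[ξ] = [η]`. -/
def IsAdaptedOn (J : ∀ x : M, Screen g k x →ₗ[ℝ] Screen g k x)
    (ξ η : ∀ x : M, TangentSpace (𝓡 4) x) (V : Set M) : Prop :=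
  SmoothFieldOn ξ V ∧ SmoothFieldOn η V ∧
  ∀ x ∈ V, ξ x ∉ Submodule.span ℝ {k x} ∧
    ∃ (hξ : ξ x ∈ Kperp g k x) (hη : η x ∈ Kperp g k x),
      J x (toScreen g k x ⟨ξ x, hξ⟩) = toScreen g k x ⟨η x, hη⟩

/-- `J` is, over `U`, the rotation by `π/2` of the oriented Euclidean plane bundle `K^⊥ / K`.
On a Euclidean plane, the isometries with square `-1` are precisely the rotations by `π/2` for the
two orientations, so that a choice of such a `J`, smooth over `U`, is a choice of an orientation
of `K^⊥ / K` over `U`. -/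
structure IsQuarterTurnOn (J : ∀ x : M, Screen g k x →ₗ[ℝ] Screen g k x) (U : Set M) : Prop where
  isometry : ∀ x ∈ U, ∀ v w v' w' : Kperp g k x,
    J x (toScreen g k x v) = toScreen g k x v' → J x (toScreen g k x w) = toScreen g k x w' →
    g.form x v' w' = g.form x v w
  sq : ∀ x ∈ U, ∀ q, J x (J x q) = -q
  smooth : ∀ x ∈ U, ∃ (V : Set M) (ξ η : ∀ y : M, TangentSpace (𝓡 4) y),
    IsOpen V ∧ x ∈ V ∧ V ⊆ U ∧ IsAdaptedOn g k J ξ η V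

/-- `N = {n ∈ ℂ ⊗ K^⊥ : J[n] = -i[n]}`, as a subspace of `ℂ ⊗ TM`. -/
def bundleN (J : ∀ x : M, Screen g k x →ₗ[ℝ] Screen g k x) (x : M) : Submodule ℂ (CT 4 x) :=
  (LinearMap.ker ((J x).baseChange ℂ ∘ₗ (toScreen g k x).baseChange ℂ
      + Complex.I • (toScreen g k x).baseChange ℂ)).map
    ((Kperp g k x).subtype.baseChange ℂ)

/-- The complex bilinear extension of `g` to `ℂ ⊗ TM`. -/
def gC (x : M) : LinearMap.BilinForm ℂ (CT 4 x) :=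
  LinearMap.BilinForm.baseChange ℂ (g.form x).toLinearMap₁₂

/-- The 2-form `g(n) ∧ g(k)` at `x`, where `g(v)` is the one-form `w ↦ g(v, w)`. -/
def formF (x : M) (n : CT 4 x) : CT 4 x →ₗ[ℂ] CT 4 x →ₗ[ℂ] ℂ :=
  wedge (gC g x n) (gC g x (cvec (k x) 0))

/-- `θ` is a smooth local flow of `k`, defined on `(-ε, ε) × U`. -/
structure IsLocalFlow (U : Set M) (ε : ℝ) (θ : ℝ × M → M) : Prop where
  isOpen : IsOpen U
  pos : 0 < ε
  smooth : ContMDiffOn (𝓘(ℝ, ℝ).prod (𝓡 4)) (𝓡 4) ∞ θ (Set.Ioo (-ε) ε ×ˢ U)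
  zero : ∀ x ∈ U, θ (0, x) = x
  integral : ∀ x ∈ U, IsMIntegralCurveOn (fun t => θ (t, x)) k (Set.Ioo (-ε) ε)

/-- `k` is null, and its flow (which exists locally, `k` being smooth) preserves `K^⊥` (that is,
`k` is conformally geodesic) and the conformal structure which `g` induces on `K^⊥` (that is, `k`
is shear-free). -/
def FlowShearFree : Prop :=
  (∀ x, g.form x (k x) (k x) = 0) ∧
  ∀ x₀ : M, ∃ (U : Set M) (ε : ℝ) (θ : ℝ × M → M), x₀ ∈ U ∧ IsLocalFlow k U ε θ ∧
    ∀ x ∈ U, ∀ t ∈ Set.Ioo (-ε) ε,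
      (∀ v ∈ Kperp g k x,
        mfderiv (𝓡 4) (𝓡 4) (fun y => θ (t, y)) x v ∈ Kperp g k (θ (t, x))) ∧
      ∃ c : ℝ, 0 < c ∧ ∀ v ∈ Kperp g k x, ∀ w ∈ Kperp g k x,
        g.form (θ (t, x)) (mfderiv (𝓡 4) (𝓡 4) (fun y => θ (t, y)) x v)
          (mfderiv (𝓡 4) (𝓡 4) (fun y => θ (t, y)) x w) = c * g.form x v w

/-- The Lie derivative `(L_k g)(Y, Z) = k(g(Y, Z)) - g([k, Y], Z) - g(Y, [k, Z])` at `x`. -/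
def lieG (Y Z : ∀ x : M, TangentSpace (𝓡 4) x) (x : M) : ℝ :=
  (show ℝ from mfderiv (𝓡 4) 𝓘(ℝ, ℝ) (fun y => g.form y (Y y) (Z y)) x (k x))
    - g.form x (VectorField.mlieBracket (𝓡 4) k Y x) (Z x)
    - g.form x (Y x) (VectorField.mlieBracket (𝓡 4) k Z x)

/-- `g(k, k) = 0` and `L_k g = lam g + φ ⊗ g(k)` for some function `lam` and some one-form `φ`,
where `⊗` is the symmetric product. -/
def LieShearFree : Prop :=
  (∀ x, g.form x (k x) (k x) = 0) ∧
  ∃ (lam : M → ℝ) (φ : ∀ x : M, TangentSpace (𝓡 4) x →L[ℝ] ℝ),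
    ∀ (U : Set M) (Y Z : ∀ x : M, TangentSpace (𝓡 4) x), IsOpen U →
      SmoothFieldOn Y U → SmoothFieldOn Z U → ∀ x ∈ U,
        lieG g k Y Z x = lam x * g.form x (Y x) (Z x)
          + (φ x (Y x) * g.form x (k x) (Z x) + φ x (Z x) * g.form x (k x) (Y x))

end Lorentz

section OrbitSpace

variable {M : Type*} [TopologicalSpace M] [ChartedSpace (EuclideanSpace ℝ (Fin 4)) M]
  {M' : Type*} [TopologicalSpace M'] [ChartedSpace (EuclideanSpace ℝ (Fin 3)) M']

/-- `π : U → M'` exhibits the 3-manifold `M'` as the space of the orbits of `k` in the open set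
`U`: it is a smooth surjective submersion whose fibres are the orbits of `k` in `U`. -/
structure IsOrbitProjection (k : ∀ x : M, TangentSpace (𝓡 4) x) (U : Set M) (π : M → M') :
    Prop where
  isOpen : IsOpen U
  smooth : ContMDiffOn (𝓡 4) (𝓡 3) ∞ π U
  surjective : π '' U = Set.univ
  submersion : ∀ p ∈ U, Function.Surjective (mfderiv (𝓡 4) (𝓡 3) π p)
  orbits : ∀ x : M', ∃ (T : Set ℝ) (γ : ℝ → M), IsOpen T ∧ T.OrdConnected ∧
    IsMIntegralCurveOn γ k T ∧ γ '' T = U ∩ π ⁻¹' {x}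

/-- The complexified differential `π_* : ℂ ⊗ T_p M → ℂ ⊗ T_{π p} M'`. -/
def push (π : M → M') (p : M) : CT 4 p →ₗ[ℂ] CT 3 (π p) :=
  (mfderiv (𝓡 4) (𝓡 3) π p).toLinearMap.baseChange ℂ

end OrbitSpace

end NullCongruence

end

open NullCongruence

noncomputable section

namespace NullCongruence

open scoped Topology

open Set Filter

/-! ### Complex tangent vectors as pairs of real ones -/

section

section ComplexVectors

/-! Write a complex vector as `a + ib`. Since `J² = -1`, it lies in `N` exactly when `a, b ∈ K^⊥`
and `J[a] = [b]` (`IsJPair`, `mem_bundleN`). Because `g` is positive definite on `K^⊥/K` and `J` is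
an isometry, one such pair with `a ∉ K` gives all others as complex multiples modulo `K`. This
yields the rank and nullity of `N`, and shows that `N` is the annihilator of `g(n) ∧ g(k)`
(`mem_bundleN_iff`).

The heart is that `π_* N` is the same at all points of a fibre. The kernel of `dπ` is `K`, so the
screens `K^⊥/K` along an orbit can be compared inside one tangent space of `M'`. Shear-freeness says
that their images agree, with proportional metrics (`SameScreen`). For the flow formulation this is
the chain rule applied to `π ∘ θ_t = π`. For the Lie derivative formulation, projectable fields `Y`
satisfy `[k, Y] ∈ K`, so `g(Y, k)` and, on `K^⊥`, `g(Y, Y')` solve scalar linear equations along the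
orbit; solutions of the same equation are proportional.

A conformal structure on a plane determines the quarter turn up to sign. Continuity excludes a
change of sign nearby (`eventually_imageJPairs_eq`) and connectedness of the orbit does the rest
(`imageJPairs_eq_of_sameScreen`). Hence `conj B = π_* N` is well defined; it is smooth because `π`
has local sections, and `B ∩ conj B = 0` because `dπ a, dπ b` are independent.

Finally, `ker dπ` lies in `N`, the annihilator of `F`, so `F` descends at each point to a form
killed by `conj B`. Such forms make up a complex line, hence for `F' = σ^* F` the pull-back `π^* F'`
is a multiple `hF`. Evaluating both forms on suitable vectors exhibits `h` as a smooth quotient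
equal to 1 on the image of `σ` (`exists_normalization`). -/

lemma exists_eq_re_add_im {V : Type*} [AddCommGroup V] [Module ℝ V] (z : ℂ ⊗[ℝ] V) :
    ∃ a b : V, z = (1 : ℂ) ⊗ₜ[ℝ] a + Complex.I ⊗ₜ[ℝ] b := by
  induction z using TensorProduct.induction_on with
  | zero => exact ⟨0, 0, by simp⟩
  | tmul c v =>
    refine ⟨c.re • v, c.im • v, ?_⟩
    rw [TensorProduct.tmul_smul, TensorProduct.tmul_smul, TensorProduct.smul_tmul',
      TensorProduct.smul_tmul', ← TensorProduct.add_tmul]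
    congr 1
    apply Complex.ext <;> simp
  | add z w hz hw =>
    obtain ⟨a, b, rfl⟩ := hz
    obtain ⟨c, d, rfl⟩ := hw
    refine ⟨a + c, b + d, ?_⟩
    simp only [TensorProduct.tmul_add]
    abel

lemma re_add_im_eq_zero {V : Type*} [AddCommGroup V] [Module ℝ V] {a b : V}
    (h : (1 : ℂ) ⊗ₜ[ℝ] a + Complex.I ⊗ₜ[ℝ] b = 0) : a = 0 ∧ b = 0 := by
  -- The maps `Re ⊗ id` and `Im ⊗ id` read off the two components.
  have h1 := congrArg (fun z => TensorProduct.lid ℝ V (LinearMap.rTensor V Complex.reLm z)) h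
  have h2 := congrArg (fun z => TensorProduct.lid ℝ V (LinearMap.rTensor V Complex.imLm z)) h
  simp at h1 h2
  exact ⟨h1, h2⟩

variable {m : ℕ} {X : Type*} [TopologicalSpace X] [ChartedSpace (EuclideanSpace ℝ (Fin m)) X]
  {x : X}

lemma exists_cvec (z : CT m x) : ∃ a b : TangentSpace (𝓡 m) x, z = cvec a b :=
  exists_eq_re_add_im z

lemma cvec_add (a b c d : TangentSpace (𝓡 m) x) :
    cvec a b + cvec c d = cvec (a + c) (b + d) := by
  simp only [cvec, TensorProduct.tmul_add]
  abel

lemma cvec_sub (a b c d : TangentSpace (𝓡 m) x) :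
    cvec a b - cvec c d = cvec (a - c) (b - d) := by
  simp only [cvec, TensorProduct.tmul_sub]
  abel

lemma smul_cvec (c : ℂ) (a b : TangentSpace (𝓡 m) x) :
    c • cvec a b = cvec (c.re • a - c.im • b) (c.re • b + c.im • a) := by
  simp only [cvec, smul_add, TensorProduct.smul_tmul', TensorProduct.tmul_sub,
    TensorProduct.tmul_add, TensorProduct.tmul_smul]
  have h1 : (c • (1 : ℂ)) = c.re • (1 : ℂ) + c.im • Complex.I := by
    apply Complex.ext <;> simp
  have h2 : (c • Complex.I) = c.re • Complex.I - c.im • (1 : ℂ) := by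
    apply Complex.ext <;> simp
  rw [h1, h2, TensorProduct.add_tmul, TensorProduct.sub_tmul]
  abel

@[simp] lemma cvec_zero : cvec (0 : TangentSpace (𝓡 m) x) 0 = 0 := by simp [cvec]

lemma cvec_eq_zero {a b : TangentSpace (𝓡 m) x} : cvec a b = 0 ↔ a = 0 ∧ b = 0 :=
  ⟨re_add_im_eq_zero, by rintro ⟨rfl, rfl⟩; simp⟩

lemma cvec_inj {a b c d : TangentSpace (𝓡 m) x} : cvec a b = cvec c d ↔ a = c ∧ b = d := by
  rw [← sub_eq_zero, cvec_sub, cvec_eq_zero, sub_eq_zero, sub_eq_zero]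

lemma conj_cvec (a b : TangentSpace (𝓡 m) x) : conj x (cvec a b) = cvec a (-b) := by
  simp [conj, cvec, TensorProduct.tmul_neg, TensorProduct.neg_tmul]

lemma mem_conjSubspace {S : Submodule ℂ (CT m x)} {a b : TangentSpace (𝓡 m) x} :
    cvec a b ∈ conjSubspace S ↔ cvec a (-b) ∈ S := by
  rw [← conj_cvec]; rfl

lemma mem_span_cvec {a b c d : TangentSpace (𝓡 m) x} :
    cvec c d ∈ Submodule.span ℂ {cvec a b} ↔
      ∃ s t : ℝ, c = s • a - t • b ∧ d = s • b + t • a := by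
  rw [Submodule.mem_span_singleton]
  constructor
  · rintro ⟨z, hz⟩
    rw [smul_cvec, cvec_inj] at hz
    exact ⟨z.re, z.im, hz.1.symm, hz.2.symm⟩
  · rintro ⟨s, t, rfl, rfl⟩
    exact ⟨⟨s, t⟩, by rw [smul_cvec]⟩

end ComplexVectors

section Pointwise

variable {M : Type*} [TopologicalSpace M] [ChartedSpace (EuclideanSpace ℝ (Fin 4)) M]
  [IsManifold (𝓡 4) ∞ M] (g : LorentzMetric M) (k : ∀ x : M, TangentSpace (𝓡 4) x)

lemma gC_cvec {x : M} (a b c d : TangentSpace (𝓡 4) x) :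
    gC g x (cvec a b) (cvec c d) =
      ⟨g.form x a c - g.form x b d, g.form x a d + g.form x b c⟩ := by
  simp only [gC, cvec, map_add, LinearMap.add_apply, LinearMap.BilinForm.baseChange_tmul]
  have h : ∀ v w, (g.form x).toLinearMap₁₂ v w = g.form x v w := fun _ _ => rfl
  simp only [h]
  apply Complex.ext <;> simp <;> ring

end Pointwise

end

/-! ### Pairs `J[a] = [b]` and the geometry of the null hyperplane `K^⊥` -/

section

variable {M : Type*} [TopologicalSpace M] [ChartedSpace (EuclideanSpace ℝ (Fin 4)) M]
  [IsManifold (𝓡 4) ∞ M] {g : LorentzMetric M} {k : ∀ x : M, TangentSpace (𝓡 4) x}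
  {J : ∀ x : M, Screen g k x →ₗ[ℝ] Screen g k x} {x : M}

variable (g k J x) in
/-- `a, b` are vectors of `K^⊥` at `x` with `J[a] = [b]`. -/
def IsJPair (a b : TangentSpace (𝓡 4) x) : Prop :=
  ∃ (ha : a ∈ Kperp g k x) (hb : b ∈ Kperp g k x),
    J x (toScreen g k x ⟨a, ha⟩) = toScreen g k x ⟨b, hb⟩

lemma mem_Kperp {v : TangentSpace (𝓡 4) x} : v ∈ Kperp g k x ↔ g.form x (k x) v = 0 := Iff.rfl

lemma toScreen_eq_zero {v : Kperp g k x} :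
    toScreen g k x v = 0 ↔ (v : TangentSpace (𝓡 4) x) ∈ Submodule.span ℝ {k x} := by
  rw [toScreen, Submodule.mkQ_apply, Submodule.Quotient.mk_eq_zero]; rfl

lemma toScreen_eq {v w : Kperp g k x} :
    toScreen g k x v = toScreen g k x w ↔
      (v - w : TangentSpace (𝓡 4) x) ∈ Submodule.span ℝ {k x} := by
  rw [← sub_eq_zero, ← map_sub, toScreen_eq_zero]; rfl

lemma toScreen_surjective : Function.Surjective (toScreen g k x) := Submodule.mkQ_surjective _

/-- The partner of a vector in `K^⊥`. -/
lemma exists_isJPair {a : TangentSpace (𝓡 4) x} (ha : a ∈ Kperp g k x) :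
    ∃ b, IsJPair g k J x a b := by
  obtain ⟨b, hb⟩ := toScreen_surjective (J x (toScreen g k x ⟨a, ha⟩))
  exact ⟨b, ha, b.2, hb.symm⟩

lemma IsJPair.rotate (hsq : ∀ q, J x (J x q) = -q) {a b : TangentSpace (𝓡 4) x}
    (h : IsJPair g k J x a b) : IsJPair g k J x b (-a) := by
  obtain ⟨ha, hb, h⟩ := h
  refine ⟨hb, (Kperp g k x).neg_mem ha, ?_⟩
  rw [← h, hsq, ← map_neg]; rfl

lemma IsJPair.add {a b c d : TangentSpace (𝓡 4) x}
    (h : IsJPair g k J x a b) (h' : IsJPair g k J x c d) : IsJPair g k J x (a + c) (b + d) := by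
  obtain ⟨ha, hb, h⟩ := h
  obtain ⟨hc, hd, h'⟩ := h'
  refine ⟨(Kperp g k x).add_mem ha hc, (Kperp g k x).add_mem hb hd, ?_⟩
  have := congrArg₂ (· + ·) h h'
  simp only [← map_add] at this
  exact this

lemma IsJPair.smul {a b : TangentSpace (𝓡 4) x} (c : ℝ)
    (h : IsJPair g k J x a b) : IsJPair g k J x (c • a) (c • b) := by
  obtain ⟨ha, hb, h⟩ := h
  refine ⟨(Kperp g k x).smul_mem c ha, (Kperp g k x).smul_mem c hb, ?_⟩
  have := congrArg (c • ·) h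
  simp only [← map_smul] at this
  exact this

/-- Separating real and imaginary parts of `J[n] = -i[n]` gives `J[a] = [b]` and `J[b] = -[a]`; the
second equation follows from the first by `J² = -1`. -/
lemma mem_bundleN (hsq : ∀ q, J x (J x q) = -q) {a b : TangentSpace (𝓡 4) x} :
    cvec a b ∈ bundleN g k J x ↔ IsJPair g k J x a b := by
  have key : ∀ a b : Kperp g k x,
      ((J x).baseChange ℂ ∘ₗ (toScreen g k x).baseChange ℂ
        + Complex.I • (toScreen g k x).baseChange ℂ)
        ((1 : ℂ) ⊗ₜ[ℝ] a + Complex.I ⊗ₜ[ℝ] b) =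
      (1 : ℂ) ⊗ₜ[ℝ] (J x (toScreen g k x a) - toScreen g k x b) +
      Complex.I ⊗ₜ[ℝ] (J x (toScreen g k x b) + toScreen g k x a) := by
    intro a b
    simp only [LinearMap.add_apply, LinearMap.comp_apply, map_add, LinearMap.baseChange_tmul,
      LinearMap.smul_apply, TensorProduct.smul_tmul', smul_eq_mul, mul_one,
      Complex.I_mul_I, TensorProduct.tmul_sub, TensorProduct.tmul_add, TensorProduct.neg_tmul]
    abel
  constructor
  · rintro ⟨z, hz, hzab⟩
    obtain ⟨a', b', rfl⟩ := exists_eq_re_add_im z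
    have h1 : cvec (a' : TangentSpace (𝓡 4) x) b' = cvec a b := by
      rw [← hzab]; simp [cvec]
    rw [cvec_inj] at h1
    obtain ⟨rfl, rfl⟩ := h1
    rw [SetLike.mem_coe, LinearMap.mem_ker, key] at hz
    exact ⟨a'.2, b'.2, sub_eq_zero.1 (re_add_im_eq_zero hz).1⟩
  · rintro ⟨ha, hb, h⟩
    refine ⟨(1 : ℂ) ⊗ₜ[ℝ] ⟨a, ha⟩ + Complex.I ⊗ₜ[ℝ] ⟨b, hb⟩, ?_, ?_⟩
    · rw [SetLike.mem_coe, LinearMap.mem_ker, key, ← h, hsq]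
      simp
    · simp [cvec]

variable (g) in
lemma form_eq_zero {v : TangentSpace (𝓡 4) x} (h : ∀ w, g.form x v w = 0) : v = 0 := by
  obtain ⟨e, he⟩ := g.signature x
  rw [← e.sum_repr v] at h ⊢
  refine Finset.sum_eq_zero fun i _ => ?_
  have := h (e i)
  simp only [map_sum, map_smul, _root_.sum_apply, _root_.smul_apply,
    he, smul_eq_mul, mul_ite, mul_one, mul_zero, mul_neg] at this
  rw [Finset.sum_ite_eq' Finset.univ i] at this
  have h0 : e.repr v i = 0 := by
    by_cases hi : i = 0 <;> simpa [hi] using this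
  rw [h0, zero_smul]

/-- A null hyperplane is positive semidefinite, with radical its null direction. -/
lemma form_self_nonneg (hn : g.form x (k x) (k x) = 0) (hk0 : k x ≠ 0)
    {v : TangentSpace (𝓡 4) x} (hv : v ∈ Kperp g k x) :
    0 ≤ g.form x v v ∧ (g.form x v v = 0 → v ∈ Submodule.span ℝ {k x}) := by
  obtain ⟨e, he⟩ := g.signature x
  have expand : ∀ v w, g.form x v w = -(e.repr v 0 * e.repr w 0) + e.repr v 1 * e.repr w 1
      + e.repr v 2 * e.repr w 2 + e.repr v 3 * e.repr w 3 := by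
    intro v w
    conv_lhs => rw [← e.sum_repr v, ← e.sum_repr w]
    simp only [map_sum, map_smul, _root_.sum_apply, _root_.smul_apply,
      he, smul_eq_mul]
    simp [Fin.sum_univ_four]
    ring
  -- A null vector without time component has vanishing spatial norm, hence is zero.
  have hk1 : e.repr (k x) 0 ≠ 0 := by
    intro h0
    apply hk0
    have h := expand (k x) (k x)
    rw [hn, h0] at h
    have h1 : e.repr (k x) 1 = 0 := by
      nlinarith [sq_nonneg (e.repr (k x) 1),
        sq_nonneg (e.repr (k x) 2), sq_nonneg (e.repr (k x) 3)]
    have h2 : e.repr (k x) 2 = 0 := by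
      nlinarith [sq_nonneg (e.repr (k x) 1),
        sq_nonneg (e.repr (k x) 2), sq_nonneg (e.repr (k x) 3)]
    have h3 : e.repr (k x) 3 = 0 := by
      nlinarith [sq_nonneg (e.repr (k x) 1),
        sq_nonneg (e.repr (k x) 2), sq_nonneg (e.repr (k x) 3)]
    apply e.repr.injective
    ext i
    fin_cases i <;> simp [h0, h1, h2, h3]
  -- Subtracting `c • k` removes the time component of `v` without changing `g(v, v)`, as `k` is
  -- null and orthogonal to `v`. What is left is a sum of three squares.
  set c := e.repr v 0 / e.repr (k x) 0 with hc
  set w := v - c • k x with hw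
  have hw0 : e.repr w 0 = 0 := by
    simp [hw, hc, div_mul_cancel₀ _ hk1]
  have hvw : g.form x v v = g.form x w w := by
    have h1 : g.form x v (k x) = 0 := by rw [g.symm]; exact hv
    have h2 : g.form x (k x) v = 0 := hv
    simp [hw, h1, h2, hn]
  rw [hvw, expand, hw0]
  refine ⟨by nlinarith [sq_nonneg (e.repr w 1), sq_nonneg (e.repr w 2), sq_nonneg (e.repr w 3)],
    fun h => ?_⟩
  have h1 : e.repr w 1 = 0 := by
      nlinarith [sq_nonneg (e.repr w 1), sq_nonneg (e.repr w 2),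
        sq_nonneg (e.repr w 3)]
  have h2 : e.repr w 2 = 0 := by
      nlinarith [sq_nonneg (e.repr w 1), sq_nonneg (e.repr w 2),
        sq_nonneg (e.repr w 3)]
  have h3 : e.repr w 3 = 0 := by
      nlinarith [sq_nonneg (e.repr w 1), sq_nonneg (e.repr w 2),
        sq_nonneg (e.repr w 3)]
  have hw' : w = 0 := by
    apply e.repr.injective
    ext i
    fin_cases i <;> simp [hw0, h1, h2, h3]
  rw [Submodule.mem_span_singleton]
  exact ⟨c, (sub_eq_zero.1 hw').symm⟩

lemma form_self_pos (hn : g.form x (k x) (k x) = 0) (hk0 : k x ≠ 0)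
    {v : TangentSpace (𝓡 4) x} (hv : v ∈ Kperp g k x) (hvk : v ∉ Submodule.span ℝ {k x}) :
    0 < g.form x v v := by
  obtain ⟨h1, h2⟩ := form_self_nonneg hn hk0 hv
  exact lt_of_le_of_ne h1 fun h => hvk (h2 h.symm)

lemma finrank_Kperp (hk0 : k x ≠ 0) : Module.finrank ℝ (Kperp g k x) = 3 := by
  have h4 : Module.finrank ℝ (TangentSpace (𝓡 4) x) = 4 :=
    finrank_euclideanSpace_fin (𝕜 := ℝ) (n := 4)
  have : FiniteDimensional ℝ (TangentSpace (𝓡 4) x) :=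
    inferInstanceAs (FiniteDimensional ℝ (EuclideanSpace ℝ (Fin 4)))
  have h := LinearMap.finrank_range_add_finrank_ker ((g.form x (k x)).toLinearMap)
  have hr : LinearMap.range ((g.form x (k x)).toLinearMap) = ⊤ := by
    apply LinearMap.range_eq_top.2
    apply LinearMap.surjective
    intro h0
    exact hk0 (form_eq_zero g fun w => by simpa using congrArg (fun f => f w) h0)
  rw [hr, finrank_top, Module.finrank_self, h4] at h
  change 1 + Module.finrank ℝ (Kperp g k x) = 4 at h
  omega

/-- A conformal frame of `K^⊥ / K` together with `k` spans `K^⊥`. -/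
lemma exists_eq_of_mem_Kperp (hn : g.form x (k x) (k x) = 0) (hk0 : k x ≠ 0)
    {a b : TangentSpace (𝓡 4) x} (ha : a ∈ Kperp g k x) (hb : b ∈ Kperp g k x)
    (hab : g.form x a b = 0) (haa : 0 < g.form x a a) (hbb : 0 < g.form x b b)
    {v : TangentSpace (𝓡 4) x} (hv : v ∈ Kperp g k x) :
    ∃ r s t : ℝ, v = r • k x + s • a + t • b := by
  have : FiniteDimensional ℝ (TangentSpace (𝓡 4) x) :=
    inferInstanceAs (FiniteDimensional ℝ (EuclideanSpace ℝ (Fin 4)))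
  have hka : g.form x (k x) a = 0 := ha
  have hkb : g.form x (k x) b = 0 := hb
  have hba : g.form x b a = 0 := by rw [g.symm]; exact hab
  let f : Fin 3 → Kperp g k x := ![⟨k x, hn⟩, ⟨a, ha⟩, ⟨b, hb⟩]
  have hli : LinearIndependent ℝ f := by
    rw [Fintype.linearIndependent_iff]
    intro c hc
    have hc' : c 0 • k x + c 1 • a + c 2 • b = 0 := by
      have := congrArg Subtype.val hc
      simpa [Fin.sum_univ_three, f] using this
    have h1 : c 1 = 0 := by
      have := congrArg (fun v => g.form x v a) hc'
      simp [hka, hba] at this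
      exact this.resolve_right haa.ne'
    have h2 : c 2 = 0 := by
      have := congrArg (fun v => g.form x v b) hc'
      simp [hkb, hab] at this
      exact this.resolve_right hbb.ne'
    have h0 : c 0 = 0 := by
      simpa [h1, h2, hk0] using hc'
    intro i
    fin_cases i <;> assumption
  have hspan := hli.span_eq_top_of_card_eq_finrank (by simp [finrank_Kperp hk0])
  have hmem : (⟨v, hv⟩ : Kperp g k x) ∈ Submodule.span ℝ (Set.range f) := by
    rw [hspan]; trivial
  obtain ⟨c, hc⟩ := (Submodule.mem_span_range_iff_exists_fun ℝ).1 hmem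
  have := congrArg Subtype.val hc
  exact ⟨c 0, c 1, c 2, by simpa [Fin.sum_univ_three, f] using this.symm⟩

end

/-! ### The bundle `N` and the annihilator of `g(n) ∧ g(k)` -/

section

variable {M : Type*} [TopologicalSpace M] [ChartedSpace (EuclideanSpace ℝ (Fin 4)) M]
  [IsManifold (𝓡 4) ∞ M] {g : LorentzMetric M} {k : ∀ x : M, TangentSpace (𝓡 4) x}
  {J : ∀ x : M, Screen g k x →ₗ[ℝ] Screen g k x} {x : M} {U : Set M}

lemma IsJPair.form_eq (hJ : IsQuarterTurnOn g k J U) (hx : x ∈ U) {a b c d : TangentSpace (𝓡 4) x}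
    (h : IsJPair g k J x a b) (h' : IsJPair g k J x c d) : g.form x b d = g.form x a c := by
  obtain ⟨ha, hb, h⟩ := h
  obtain ⟨hc, hd, h'⟩ := h'
  exact hJ.isometry x hx ⟨a, ha⟩ ⟨c, hc⟩ ⟨b, hb⟩ ⟨d, hd⟩ h h'

/-- The isometry `J` takes the pair `(a, b)` to `(b, -a)`, so `g(a, b) = -g(b, a)`. -/
lemma IsJPair.form_orth (hJ : IsQuarterTurnOn g k J U) (hx : x ∈ U) {a b : TangentSpace (𝓡 4) x}
    (h : IsJPair g k J x a b) : g.form x a b = 0 := by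
  have := h.form_eq hJ hx (h.rotate (hJ.sq x hx))
  rw [map_neg, g.symm] at this
  linarith

lemma IsJPair.sub_mem_span {a b b' : TangentSpace (𝓡 4) x}
    (h : IsJPair g k J x a b) (h' : IsJPair g k J x a b') :
    b - b' ∈ Submodule.span ℝ {k x} := by
  obtain ⟨ha, hb, h⟩ := h
  obtain ⟨ha', hb', h'⟩ := h'
  exact toScreen_eq.1 (h.symm.trans h')

lemma IsJPair.of_sub_mem_span {a b a' b' : TangentSpace (𝓡 4) x}
    (hn : g.form x (k x) (k x) = 0) (h : IsJPair g k J x a b)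
    (ha : a' - a ∈ Submodule.span ℝ {k x}) (hb : b' - b ∈ Submodule.span ℝ {k x}) :
    IsJPair g k J x a' b' := by
  have hK : Submodule.span ℝ {k x} ≤ Kperp g k x := by
    rw [Submodule.span_singleton_le_iff_mem]; exact hn
  obtain ⟨ha0, hb0, h⟩ := h
  have ha1 : a' ∈ Kperp g k x := by simpa using (Kperp g k x).add_mem (hK ha) ha0
  have hb1 : b' ∈ Kperp g k x := by simpa using (Kperp g k x).add_mem (hK hb) hb0
  refine ⟨ha1, hb1, ?_⟩
  have h1 : toScreen g k x ⟨a', ha1⟩ = toScreen g k x ⟨a, ha0⟩ := toScreen_eq.2 ha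
  have h2 : toScreen g k x ⟨b', hb1⟩ = toScreen g k x ⟨b, hb0⟩ := toScreen_eq.2 hb
  rw [h1, h2, h]

/-- A `J`-pair off `K` determines all others, up to `K`, as its complex multiples. -/
lemma IsJPair.exists_eq (hn : g.form x (k x) (k x) = 0) (hk0 : k x ≠ 0)
    (hJ : IsQuarterTurnOn g k J U) (hx : x ∈ U) {a b c d : TangentSpace (𝓡 4) x}
    (h : IsJPair g k J x a b) (hak : a ∉ Submodule.span ℝ {k x}) (h' : IsJPair g k J x c d) :
    ∃ s t r r' : ℝ, c = s • a - t • b + r • k x ∧ d = s • b + t • a + r' • k x := by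
  have haa := form_self_pos hn hk0 h.1 hak
  have hbb : 0 < g.form x b b := by rw [h.form_eq hJ hx h]; exact haa
  obtain ⟨r, s, t, hc⟩ := exists_eq_of_mem_Kperp hn hk0 h.1 h.2.1 (h.form_orth hJ hx) haa hbb h'.1
  -- Since `J[b] = -[a]`, the partner of `s a + t b` is `s b - t a`; this is multiplication of `a +
  -- ib` by `s - it`, whence the coefficient `-t` below.
  have h1 : IsJPair g k J x (s • a + t • b) (s • b + t • (-a)) :=
    (h.smul s).add ((h.rotate (hJ.sq x hx)).smul t)
  have h2 : IsJPair g k J x c (s • b + t • (-a)) := by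
    refine h1.of_sub_mem_span hn ?_ (by simp)
    rw [Submodule.mem_span_singleton]
    exact ⟨r, by rw [hc]; module⟩
  obtain ⟨r', hr'⟩ := Submodule.mem_span_singleton.1 (h'.sub_mem_span h2)
  refine ⟨s, -t, r, r', by rw [hc]; module, ?_⟩
  rw [sub_eq_iff_eq_add.1 hr'.symm]
  module

/-- Independence of `a, b` modulo `K`: pairing with `a` and with `b` removes `k`, and `a, b` are
orthogonal of equal positive length. -/
lemma IsJPair.not_mem_span (hn : g.form x (k x) (k x) = 0) (hk0 : k x ≠ 0)
    (hJ : IsQuarterTurnOn g k J U) (hx : x ∈ U) {a b : TangentSpace (𝓡 4) x}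
    (h : IsJPair g k J x a b) (hak : a ∉ Submodule.span ℝ {k x}) {s t r : ℝ}
    (h0 : s • a + t • b = r • k x) : s = 0 ∧ t = 0 := by
  have haa := form_self_pos hn hk0 h.1 hak
  have hbb := h.form_eq hJ hx h
  have hab := h.form_orth hJ hx
  have hba : g.form x b a = 0 := by rw [g.symm]; exact hab
  have hka : g.form x (k x) a = 0 := h.1
  have hkb : g.form x (k x) b = 0 := h.2.1
  have h1 := congrArg (fun v => g.form x v a) h0
  have h2 := congrArg (fun v => g.form x v b) h0
  simp [hba, hka, haa.ne'] at h1
  simp [hab, hkb, hbb, haa.ne'] at h2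
  exact ⟨h1, h2⟩

lemma bundleN_eq_span (hn : g.form x (k x) (k x) = 0) (hk0 : k x ≠ 0)
    (hJ : IsQuarterTurnOn g k J U) (hx : x ∈ U) {a b : TangentSpace (𝓡 4) x}
    (h : IsJPair g k J x a b) (hak : a ∉ Submodule.span ℝ {k x}) :
    bundleN g k J x = Submodule.span ℂ {cvec a b, cvec (k x) 0} := by
  apply le_antisymm
  · intro z hz
    obtain ⟨c, d, rfl⟩ := exists_cvec z
    rw [mem_bundleN (hJ.sq x hx)] at hz
    obtain ⟨s, t, r, r', rfl, rfl⟩ := h.exists_eq hn hk0 hJ hx hak hz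
    rw [Submodule.mem_span_pair]
    refine ⟨⟨s, t⟩, ⟨r, r'⟩, ?_⟩
    rw [smul_cvec, smul_cvec, cvec_add]
    simp
  · rw [Submodule.span_le]
    rintro z (rfl | rfl)
    · exact (mem_bundleN (hJ.sq x hx)).2 h
    · refine (mem_bundleN (hJ.sq x hx)).2 ⟨hn, (Kperp g k x).zero_mem, ?_⟩
      rw [toScreen_eq_zero.2 (Submodule.mem_span_singleton_self _), map_zero, eq_comm,
        toScreen_eq_zero]
      exact Submodule.zero_mem _

lemma finrank_bundleN (hn : g.form x (k x) (k x) = 0) (hk0 : k x ≠ 0)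
    (hJ : IsQuarterTurnOn g k J U) (hx : x ∈ U) {a b : TangentSpace (𝓡 4) x}
    (h : IsJPair g k J x a b) (hak : a ∉ Submodule.span ℝ {k x}) :
    Module.finrank ℂ (bundleN g k J x) = 2 := by
  have hli : LinearIndependent ℂ ![cvec a b, cvec (k x) 0] := by
    rw [LinearIndependent.pair_iff]
    intro s t hst
    rw [smul_cvec, smul_cvec, cvec_add, cvec_eq_zero] at hst
    have h1 := h.not_mem_span hn hk0 hJ hx hak (s := s.re) (t := -s.im) (r := -t.re) (by
      rw [← sub_eq_zero, ← hst.1]; module)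
    have hs : s = 0 := Complex.ext h1.1 (by simpa using h1.2)
    refine ⟨hs, ?_⟩
    simp [hs, hk0] at hst
    exact Complex.ext hst.1 hst.2
  have := finrank_span_eq_card hli
  rw [bundleN_eq_span hn hk0 hJ hx h hak]
  rwa [Matrix.range_cons_cons_empty, Fintype.card_fin] at this

/-- On the screen, `g([u], [v]) = g(J[u], J[v]) = (-i)² g([u], [v])`. In real terms, the two parts
vanish by isometry for the pairs `(c, d)` and `(d, -c)`. -/
lemma gC_eq_zero_of_mem_bundleN (hJ : IsQuarterTurnOn g k J U) (hx : x ∈ U) {u v : CT 4 x}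
    (hu : u ∈ bundleN g k J x) (hv : v ∈ bundleN g k J x) : gC g x u v = 0 := by
  obtain ⟨a, b, rfl⟩ := exists_cvec u
  obtain ⟨c, d, rfl⟩ := exists_cvec v
  rw [mem_bundleN (hJ.sq x hx)] at hu hv
  have h1 := hu.form_eq hJ hx hv
  have h2 := hu.form_eq hJ hx (hv.rotate (hJ.sq x hx))
  rw [map_neg] at h2
  rw [gC_cvec]
  apply Complex.ext <;> simp <;> linarith

lemma formF_apply (n u v : CT 4 x) : formF g k x n u v =
    gC g x n u * gC g x (cvec (k x) 0) v - gC g x (cvec (k x) 0) u * gC g x n v := by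
  simp [formF, wedge]

lemma exists_form_ne_zero (hk0 : k x ≠ 0) : ∃ w, g.form x (k x) w ≠ 0 := by
  by_contra! h
  exact hk0 (form_eq_zero g h)

lemma formF_eq_zero_of_gC {n v : CT 4 x} (h1 : gC g x n v = 0)
    (h2 : gC g x (cvec (k x) 0) v = 0) : formF g k x n v = 0 := by
  ext w
  simp [formF_apply, h1, h2]

lemma cvec_k_mem_bundleN (hn : g.form x (k x) (k x) = 0)
    (hJ : IsQuarterTurnOn g k J U) (hx : x ∈ U) : cvec (k x) 0 ∈ bundleN g k J x := by
  refine (mem_bundleN (hJ.sq x hx)).2 ⟨hn, (Kperp g k x).zero_mem, ?_⟩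
  rw [toScreen_eq_zero.2 (Submodule.mem_span_singleton_self _), map_zero, eq_comm,
    toScreen_eq_zero]
  exact Submodule.zero_mem _

/-- The annihilator of `g(n) ∧ g(k)` is `N`. -/
lemma mem_bundleN_iff (hn : g.form x (k x) (k x) = 0) (hk0 : k x ≠ 0)
    (hJ : IsQuarterTurnOn g k J U) (hx : x ∈ U) {a b : TangentSpace (𝓡 4) x}
    (h : IsJPair g k J x a b) (hak : a ∉ Submodule.span ℝ {k x}) (v : CT 4 x) :
    v ∈ bundleN g k J x ↔ formF g k x (cvec a b) v = 0 := by
  have haa := form_self_pos hn hk0 h.1 hak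
  have hab := h.form_orth hJ hx
  have hba : g.form x b a = 0 := by rw [g.symm]; exact hab
  have hka : g.form x (k x) a = 0 := h.1
  constructor
  · intro hv
    exact formF_eq_zero_of_gC
      (gC_eq_zero_of_mem_bundleN hJ hx ((mem_bundleN (hJ.sq x hx)).2 h) hv)
      (gC_eq_zero_of_mem_bundleN hJ hx (cvec_k_mem_bundleN hn hJ hx) hv)
  · intro hF
    -- Evaluation on `a` isolates `g(k, v)`, since `g(k, a) = 0` and `g(n, a) = g(a, a) ≠ 0`.
    have h1 : gC g x (cvec (k x) 0) v = 0 := by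
      have e0 : gC g x (cvec (k x) 0) (cvec a 0) = 0 := by
        rw [gC_cvec]; apply Complex.ext <;> simp [hka]
      have e1 : gC g x (cvec a b) (cvec a 0) = (g.form x a a : ℂ) := by
        rw [gC_cvec]; apply Complex.ext <;> simp [hba]
      have := congrArg (fun f => f (cvec a 0)) hF
      simpa [formF_apply, e0, e1, haa.ne'] using this
    obtain ⟨w, hw⟩ := exists_form_ne_zero (g := g) hk0
    -- With `g(k, v) = 0`, evaluation on a vector not orthogonal to `k` isolates `g(n, v)`.
    have h2 : gC g x (cvec a b) v = 0 := by
      have := congrArg (fun f => f (cvec w 0)) hF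
      simp [formF_apply, h1] at this
      refine this.resolve_right fun h => hw ?_
      simpa [gC_cvec] using congrArg Complex.re h
    obtain ⟨c, d, rfl⟩ := exists_cvec v
    rw [gC_cvec, Complex.ext_iff] at h1 h2
    simp at h1 h2
    -- For `v = c + id`, let `e` be a partner of `c`. The equation `g(n, v) = 0` makes `d - e`
    -- orthogonal to both `a` and `b`, so `d - e ∈ K` and `d` is a partner too.
    obtain ⟨e, he⟩ := exists_isJPair (J := J) (x := x) (a := c) h1.1
    have hde : d - e ∈ Kperp g k x := (Kperp g k x).sub_mem h1.2 he.2.1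
    have e1 := h.form_eq hJ hx he
    have e2 := h.form_eq hJ hx (he.rotate (hJ.sq x hx))
    rw [map_neg] at e2
    have hbb : 0 < g.form x b b := by rw [h.form_eq hJ hx h]; exact haa
    obtain ⟨r, s, t, hd⟩ := exists_eq_of_mem_Kperp hn hk0 h.1 h.2.1 hab haa hbb hde
    have hkb : g.form x (k x) b = 0 := h.2.1
    have hak' : g.form x a (k x) = 0 := by rw [g.symm]; exact hka
    have hbk' : g.form x b (k x) = 0 := by rw [g.symm]; exact hkb
    have f1 := congrArg (g.form x a) hd
    have f2 := congrArg (g.form x b) hd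
    simp [hab, hak'] at f1
    simp [hba, hbk'] at f2
    have hs : s = 0 := by
      have : s * g.form x a a = 0 := by linarith [h2.2]
      exact (mul_eq_zero.1 this).resolve_right haa.ne'
    have ht : t = 0 := by
      have : t * g.form x b b = 0 := by linarith [h2.1]
      exact (mul_eq_zero.1 this).resolve_right hbb.ne'
    rw [mem_bundleN (hJ.sq x hx)]
    refine he.of_sub_mem_span hn (by simp) ?_
    rw [hd, hs, ht, Submodule.mem_span_singleton]
    exact ⟨r, by simp⟩

end

/-! ### Smoothness of tangent maps and of the metric -/

section

section TangentMap

variable {E : Type*} [NormedAddCommGroup E] [NormedSpace ℝ E]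
  {H : Type*} [TopologicalSpace H] {I : ModelWithCorners ℝ E H}
  {X : Type*} [TopologicalSpace X] [ChartedSpace H X] [IsManifold I ∞ X]
  {E' : Type*} [NormedAddCommGroup E'] [NormedSpace ℝ E']
  {H' : Type*} [TopologicalSpace H'] {I' : ModelWithCorners ℝ E' H'}
  {Y : Type*} [TopologicalSpace Y] [ChartedSpace H' Y] [IsManifold I' ∞ Y]
  {EZ : Type*} [NormedAddCommGroup EZ] [NormedSpace ℝ EZ]
  {HZ : Type*} [TopologicalSpace HZ] {IZ : ModelWithCorners ℝ EZ HZ}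
  {Z : Type*} [TopologicalSpace Z] [ChartedSpace HZ Z]

/-- The tangent map of a smooth map, along a smooth family of tangent vectors, is smooth. -/
lemma contMDiffAt_tangentMap_comp {f : X → Y} {v : Z → TangentBundle I X} {z : Z}
    (hf : ContMDiffAt I I' ∞ f (v z).proj) (hv : ContMDiffAt IZ I.tangent ∞ v z) :
    ContMDiffAt IZ I'.tangent ∞ (fun z => tangentMap I I' f (v z)) z := by
  have : IsManifold I 1 X := IsManifold.of_le (n := ∞) (by simp)
  have : IsManifold I' 1 Y := IsManifold.of_le (n := ∞) (by simp)
  have hb : ContMDiffAt IZ I ∞ (fun z => (v z).proj) z :=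
    (Bundle.contMDiff_proj (TangentSpace I (M := X))).contMDiffAt.comp z hv
  have A := hf.mfderiv_const (m := ∞) (by simp)
  have A' := A.comp z hb
  exact ContMDiffAt.clm_apply_of_inCoordinates (E₁ := TangentSpace I (M := X))
    (E₂ := TangentSpace I' (M := Y)) (b₁ := fun z => (v z).proj) (v := fun z => (v z).2)
    (b₂ := fun z => f (v z).proj) (ϕ := fun z => mfderiv I I' f (v z).proj) A' hv (hf.comp z hb)

/-- The derivative of a smooth vector valued map along a smooth family of tangent vectors is
smooth. -/
lemma contMDiffAt_mfderiv_apply {f : X → E'} {v : Z → TangentBundle I X} {z : Z}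
    (hf : ContMDiffAt I 𝓘(ℝ, E') ∞ f (v z).proj) (hv : ContMDiffAt IZ I.tangent ∞ v z) :
    ContMDiffAt IZ 𝓘(ℝ, E') ∞ (fun z => (mfderiv I 𝓘(ℝ, E') f (v z).proj (v z).2 : E')) z :=
  (contMDiff_snd_tangentBundle_modelSpace E' 𝓘(ℝ, E')).contMDiffAt.comp z
    (contMDiffAt_tangentMap_comp hf hv)

end TangentMap

section Metric

variable {M : Type*} [TopologicalSpace M] [ChartedSpace (EuclideanSpace ℝ (Fin 4)) M]
  [IsManifold (𝓡 4) ∞ M] (g : LorentzMetric M)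
  {EZ : Type*} [NormedAddCommGroup EZ] [NormedSpace ℝ EZ]
  {HZ : Type*} [TopologicalSpace HZ] {IZ : ModelWithCorners ℝ EZ HZ}
  {Z : Type*} [TopologicalSpace Z] [ChartedSpace HZ Z]

lemma contMDiffAt_form {b : Z → M} {v w : ∀ z, TangentSpace (𝓡 4) (b z)} {z : Z}
    (hv : ContMDiffAt IZ (𝓡 4).tangent ∞ (fun z => (⟨b z, v z⟩ : TangentBundle (𝓡 4) M)) z)
    (hw : ContMDiffAt IZ (𝓡 4).tangent ∞ (fun z => (⟨b z, w z⟩ : TangentBundle (𝓡 4) M)) z) :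
    ContMDiffAt IZ 𝓘(ℝ, ℝ) ∞ (fun z => g.form (b z) (v z) (w z)) z := by
  have hb : ContMDiffAt IZ (𝓡 4) ∞ b z :=
    (Bundle.contMDiff_proj (TangentSpace (𝓡 4) (M := M))).contMDiffAt.comp z hv
  have h := ContMDiffAt.clm_bundle_apply₂ (F₁ := EuclideanSpace ℝ (Fin 4))
    (F₂ := EuclideanSpace ℝ (Fin 4)) (F₃ := ℝ) (E₁ := TangentSpace (𝓡 4) (M := M))
    (E₂ := TangentSpace (𝓡 4) (M := M)) (E₃ := Bundle.Trivial M ℝ)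
    (ψ := fun z => g.form (b z)) (g.smooth.contMDiffAt.comp z hb) hv hw
  rw [Bundle.contMDiffAt_totalSpace] at h
  exact h.2

end Metric

/-! ### Local sections of a submersion -/

section LocalSection

/-- A submersion has smooth local sections through every point. -/
lemma exists_local_section {m n : ℕ}
    {X : Type*} [TopologicalSpace X] [ChartedSpace (EuclideanSpace ℝ (Fin m)) X]
    [IsManifold (𝓡 m) ∞ X]
    {Y : Type*} [TopologicalSpace Y] [ChartedSpace (EuclideanSpace ℝ (Fin n)) Y]
    [IsManifold (𝓡 n) ∞ Y] {f : X → Y} {U : Set X} (hU : IsOpen U)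
    (hf : ContMDiffOn (𝓡 m) (𝓡 n) ∞ f U) {p : X} (hp : p ∈ U)
    (hs : Function.Surjective (mfderiv (𝓡 m) (𝓡 n) f p)) :
    ∃ (W : Set Y) (σ : Y → X), IsOpen W ∧ f p ∈ W ∧ ContMDiffOn (𝓡 n) (𝓡 m) ∞ σ W ∧
      MapsTo σ W U ∧ (∀ y ∈ W, f (σ y) = y) ∧ σ (f p) = p := by
  have : IsManifold (𝓡 m) 1 X := IsManifold.of_le (n := ∞) (by simp)
  have : IsManifold (𝓡 n) 1 Y := IsManifold.of_le (n := ∞) (by simp)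
  set φ := extChartAt (𝓡 m) p
  set ψ := extChartAt (𝓡 n) (f p)
  let A : EuclideanSpace ℝ (Fin m) →L[ℝ] EuclideanSpace ℝ (Fin n) := mfderiv (𝓡 m) (𝓡 n) f p
  have hA : Function.Surjective A := hs
  obtain ⟨R₀, hR₀⟩ := A.toLinearMap.exists_rightInverse_of_surjective
    (LinearMap.range_eq_top.2 hA)
  let R : EuclideanSpace ℝ (Fin n) →L[ℝ] EuclideanSpace ℝ (Fin m) := R₀.toContinuousLinearMap
  have hR : ∀ z, A (R z) = z := fun z => congrArg (fun l => l z) hR₀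
  -- An affine slice through `p` in the chart, in the directions of a right inverse `R` of the
  -- differential.
  let j : EuclideanSpace ℝ (Fin n) → X := fun z => φ.symm (φ p + R z)
  have hj0 : j 0 = p := by simp [j, φ]
  have haff : ContDiff ℝ ∞ (fun z => φ p + R z) := contDiff_const.add R.contDiff
  have hjs : ∀ z, φ p + R z ∈ φ.target → ContMDiffAt (𝓡 n) (𝓡 m) ∞ j z := by
    intro z hz
    exact ((contMDiffOn_extChartAt_symm (I := 𝓡 m) (n := ∞) p).contMDiffAt
      ((isOpen_extChartAt_target p).mem_nhds hz)).comp z haff.contMDiff.contMDiffAt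
  have htar : ∀ᶠ z in 𝓝 (0 : EuclideanSpace ℝ (Fin n)), φ p + R z ∈ φ.target := by
    apply haff.continuous.continuousAt.eventually_mem
    rw [map_zero, add_zero]
    exact extChartAt_target_mem_nhds (I := 𝓡 m) p
  have hjc : ContinuousAt j 0 := (hjs 0 htar.self_of_nhds).continuousAt
  -- On the slice, `f` read in charts has derivative `A ∘ R = id` at 0. The section is `j` after the
  -- local inverse of `F`.
  let F : EuclideanSpace ℝ (Fin n) → EuclideanSpace ℝ (Fin n) := fun z => ψ (f (j z))
  have hjU : ∀ᶠ z in 𝓝 (0 : EuclideanSpace ℝ (Fin n)), j z ∈ U :=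
    hjc.eventually_mem (by rw [hj0]; exact hU.mem_nhds hp)
  have hfat : ∀ q ∈ U, ContMDiffAt (𝓡 m) (𝓡 n) ∞ f q := fun q hq => hf.contMDiffAt (hU.mem_nhds hq)
  have hfj : ∀ᶠ z in 𝓝 (0 : EuclideanSpace ℝ (Fin n)), f (j z) ∈ ψ.source := by
    have : ContinuousAt (fun z => f (j z)) 0 :=
      ContinuousAt.comp (g := f) (by rw [hj0]; exact (hfat p hp).continuousAt) hjc
    exact this.eventually_mem (by rw [hj0]; exact extChartAt_source_mem_nhds (I := 𝓡 n) (f p))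
  have hψs : ∀ y ∈ ψ.source, ContMDiffAt (𝓡 n) 𝓘(ℝ, EuclideanSpace ℝ (Fin n)) ∞ ψ y := by
    intro y hy
    exact contMDiffAt_extChartAt' (by rwa [extChartAt_source] at hy)
  have hFs : ∀ᶠ z in 𝓝 (0 : EuclideanSpace ℝ (Fin n)), ContDiffAt ℝ ∞ F z := by
    filter_upwards [htar, hjU, hfj] with z h1 h2 h3
    rw [← contMDiffAt_iff_contDiffAt]
    exact (hψs _ h3).comp z ((hfat _ h2).comp z (hjs z h1))
  have hF0 := hFs.self_of_nhds
  have hder : HasFDerivAt F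
      ((ContinuousLinearEquiv.refl ℝ (EuclideanSpace ℝ (Fin n)) :
        EuclideanSpace ℝ (Fin n) →L[ℝ] EuclideanSpace ℝ (Fin n))) 0 := by
    have h1 : HasFDerivAt (writtenInExtChartAt (𝓡 m) (𝓡 n) p f) A (φ p + R 0) := by
      have h2 := ((hfat p hp).mdifferentiableAt (by simp)).hasMFDerivAt.2
      rw [ModelWithCorners.range_eq_univ] at h2
      have h3 : HasFDerivWithinAt (writtenInExtChartAt (𝓡 m) (𝓡 n) p f) A univ (φ p) := h2
      rw [map_zero, add_zero]
      exact h3.hasFDerivAt univ_mem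
    refine (h1.comp (0 : EuclideanSpace ℝ (Fin n))
      (R.hasFDerivAt.const_add (φ p))).congr_fderiv ?_
    ext z : 1
    exact hR z
  have hne : (∞ : WithTop ℕ∞) ≠ 0 := by simp
  let e := hF0.toOpenPartialHomeomorph F hder hne
  have he : ∀ z, e z = F z := fun z => rfl
  have h0s : (0 : EuclideanSpace ℝ (Fin n)) ∈ e.source :=
    hF0.mem_toOpenPartialHomeomorph_source hder hne
  have hF00 : F 0 = ψ (f p) := by simp [F, hj0]
  have het : ψ (f p) ∈ e.target := by rw [← hF00]; exact e.map_source h0s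
  have hes : e.symm (ψ (f p)) = 0 := by rw [← hF00]; exact e.left_inv h0s
  -- The inverse must be smooth at all points near `ψ (f p)`, which requires invertible derivatives
  -- near 0 and not only at 0.
  have hinv : ∀ᶠ z in 𝓝 (0 : EuclideanSpace ℝ (Fin n)),
      fderiv ℝ F z ∈ range ((↑) : (EuclideanSpace ℝ (Fin n) ≃L[ℝ] EuclideanSpace ℝ (Fin n)) →
        EuclideanSpace ℝ (Fin n) →L[ℝ] EuclideanSpace ℝ (Fin n)) := by
    have hc : ContinuousAt (fderiv ℝ F) 0 := hF0.continuousAt_fderiv (by simp)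
    refine hc.eventually_mem ?_
    rw [hder.fderiv]
    exact ContinuousLinearEquiv.nhds _
  let τ : Y → EuclideanSpace ℝ (Fin n) := fun y => e.symm (ψ y)
  have hτ : Tendsto τ (𝓝 (f p)) (𝓝 0) := by
    have h1 : ContinuousAt e.symm (ψ (f p)) := e.continuousAt_symm het
    have h2 : ContinuousAt ψ (f p) := continuousAt_extChartAt (I := 𝓡 n) (f p)
    have := ContinuousAt.comp h1 h2
    rw [ContinuousAt] at this
    rwa [Function.comp_apply, hes] at this
  have key : ∀ᶠ y in 𝓝 (f p), ContMDiffAt (𝓡 n) (𝓡 m) ∞ (fun y => j (τ y)) y ∧ j (τ y) ∈ U ∧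
      f (j (τ y)) = y := by
    filter_upwards [extChartAt_source_mem_nhds (I := 𝓡 n) (f p),
      (continuousAt_extChartAt (I := 𝓡 n) (f p)).eventually_mem (e.open_target.mem_nhds het),
      hτ.eventually htar, hτ.eventually hjU, hτ.eventually hfj, hτ.eventually hFs,
      hτ.eventually hinv] with y h1 h2 h3 h4 h5 h6 h7
    refine ⟨?_, h4, ?_⟩
    · obtain ⟨L, hL⟩ := h7
      have hd : HasFDerivAt F (L : EuclideanSpace ℝ (Fin n) →L[ℝ] EuclideanSpace ℝ (Fin n))
          (τ y) := by
        rw [hL]; exact (h6.differentiableAt hne).hasFDerivAt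
      have hsy : ContDiffAt ℝ ∞ e.symm (ψ y) := e.contDiffAt_symm h2 hd h6
      exact (hjs _ h3).comp y (hsy.contMDiffAt.comp y (hψs y h1))
    · have : F (τ y) = ψ y := e.right_inv h2
      exact ψ.injOn h5 h1 this
  obtain ⟨W, hW, hWo, hpW⟩ := eventually_nhds_iff.1 key
  refine ⟨W, fun y => j (τ y), hWo, hpW, fun y hy => (hW y hy).1.contMDiffWithinAt,
    fun y hy => (hW y hy).2.1, fun y hy => (hW y hy).2.2, ?_⟩
  simp only [τ]
  rw [hes, hj0]

end LocalSection

/-! ### Brackets of projectable fields -/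

section Bracket

/-- If `df(Y)` and `df(Z)` are locally constant, then `df([Y, Z]) = 0`. -/
lemma mfderiv_mlieBracket_eq_zero {m : ℕ} {F : Type*} [NormedAddCommGroup F] [NormedSpace ℝ F]
    {X : Type*} [TopologicalSpace X] [ChartedSpace (EuclideanSpace ℝ (Fin m)) X]
    [IsManifold (𝓡 m) ∞ X] {f : X → F} {p : X} {c d : F}
    (hf : ContMDiffAt (𝓡 m) 𝓘(ℝ, F) ∞ f p) {Y Z : ∀ x : X, TangentSpace (𝓡 m) x}
    (hY : ContMDiffAt (𝓡 m) (𝓡 m).tangent ∞ (fun x => (⟨x, Y x⟩ : TangentBundle (𝓡 m) X)) p)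
    (hZ : ContMDiffAt (𝓡 m) (𝓡 m).tangent ∞ (fun x => (⟨x, Z x⟩ : TangentBundle (𝓡 m) X)) p)
    (hc : ∀ᶠ q in 𝓝 p, mfderiv (𝓡 m) 𝓘(ℝ, F) f q (Y q) = c)
    (hd : ∀ᶠ q in 𝓝 p, mfderiv (𝓡 m) 𝓘(ℝ, F) f q (Z q) = d) :
    mfderiv (𝓡 m) 𝓘(ℝ, F) f p (VectorField.mlieBracket (𝓡 m) Y Z p) = 0 := by
  have : IsManifold (𝓡 m) 1 X := IsManifold.of_le (n := ∞) (by simp)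
  have : IsManifold (𝓡 m) 2 X := IsManifold.of_le (n := ∞) ENat.LEInfty.out
  set φ := extChartAt (𝓡 m) p with hφ
  let pull (W : ∀ x : X, TangentSpace (𝓡 m) x) (y : EuclideanSpace ℝ (Fin m)) :
      EuclideanSpace ℝ (Fin m) :=
    VectorField.mpullbackWithin 𝓘(ℝ, EuclideanSpace ℝ (Fin m)) (𝓡 m) φ.symm W (range (𝓡 m)) y
  let F' : EuclideanSpace ℝ (Fin m) → F := fun y => f (φ.symm y)
  have hpull : ∀ W : ∀ x : X, TangentSpace (𝓡 m) x,
      ContMDiffAt (𝓡 m) (𝓡 m).tangent ∞ (fun x => (⟨x, W x⟩ : TangentBundle (𝓡 m) X)) p →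
      DifferentiableAt ℝ (pull W) (φ p) := by
    intro W hW
    have h := MDifferentiableWithinAt.differentiableWithinAt_mpullbackWithin_vectorField
      (hW.mdifferentiableAt (by simp)).mdifferentiableWithinAt (s := univ)
    rw [preimage_univ, univ_inter] at h
    exact h.differentiableAt (by rw [ModelWithCorners.range_eq_univ]; exact univ_mem)
  have hF' : ContDiffAt ℝ ∞ F' (φ p) := by
    rw [← contMDiffAt_iff_contDiffAt]
    refine ContMDiffAt.comp (φ p) (g := f) ?_ ((contMDiffOn_extChartAt_symm (I := 𝓡 m) (n := ∞) p
      ).contMDiffAt (extChartAt_target_mem_nhds p))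
    rw [hφ, extChartAt_to_inv]
    exact hf
  have hmd : ∀ᶠ q in 𝓝 p, MDifferentiableAt (𝓡 m) 𝓘(ℝ, F) f q := by
    have h1 : ContMDiffAt (𝓡 m) 𝓘(ℝ, F) 1 f p := hf.of_le (by simp)
    filter_upwards [(contMDiffAt_iff_contMDiffAt_nhds (by simp)).1 h1] with q hq
    exact hq.mdifferentiableAt (by simp)
  have hchain : ∀ (W : ∀ x : X, TangentSpace (𝓡 m) x) (c : F),
      (∀ᶠ q in 𝓝 p, mfderiv (𝓡 m) 𝓘(ℝ, F) f q (W q) = c) →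
      (fun y => fderiv ℝ F' y (pull W y)) =ᶠ[𝓝 (φ p)] fun _ => c := by
    intro W c hc
    have hsymm : Tendsto φ.symm (𝓝 (φ p)) (𝓝 p) := by
      have := continuousAt_extChartAt_symm (I := 𝓡 m) p
      rw [ContinuousAt, extChartAt_to_inv] at this
      exact this
    filter_upwards [extChartAt_target_mem_nhds (I := 𝓡 m) p, hsymm.eventually hc,
      hsymm.eventually hmd] with y hy h1 h2
    have h3 : MDifferentiableAt 𝓘(ℝ, EuclideanSpace ℝ (Fin m)) (𝓡 m) φ.symm y :=
      ((contMDiffOn_extChartAt_symm (I := 𝓡 m) (n := ∞) p).contMDiffAt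
        ((isOpen_extChartAt_target p).mem_nhds hy)).mdifferentiableAt (by simp)
    have h4 := mfderiv_comp y h2 h3
    obtain ⟨L, hL⟩ := isInvertible_mfderivWithin_extChartAt_symm (I := 𝓡 m) hy
    have h7 : mfderiv 𝓘(ℝ, EuclideanSpace ℝ (Fin m)) (𝓡 m) φ.symm y = L := by
      rw [hL, ModelWithCorners.range_eq_univ, mfderivWithin_univ]
    have h8 : pull W y = L.symm (W (φ.symm y)) := by
      change (mfderivWithin 𝓘(ℝ, EuclideanSpace ℝ (Fin m)) (𝓡 m) φ.symm (range (𝓡 m)) y).inverse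
        (W (φ.symm y)) = _
      rw [← hL, ContinuousLinearMap.inverse_equiv]
      rfl
    rw [← h1]
    have h6 : fderiv ℝ F' y = mfderiv 𝓘(ℝ, EuclideanSpace ℝ (Fin m)) 𝓘(ℝ, F) (f ∘ φ.symm) y :=
      mfderiv_eq_fderiv.symm
    have h9 := congrArg (fun l => l (L.symm (W (φ.symm y)))) h4
    rw [h8, h6]
    refine h9.trans ?_
    rw [ContinuousLinearMap.comp_apply, h7]
    exact congrArg (mfderiv (𝓡 m) 𝓘(ℝ, F) f (φ.symm y)) (L.apply_symm_apply _)
  -- In the chart, symmetry of the second derivative gives `dF'([Y, Z]) = Y(dF' Z) - Z(dF' Y)`, and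
  -- both functions being differentiated are locally constant.
  have hb := VectorField.fderiv_apply_lieBracket hF' (by simpa using ENat.LEInfty.out) (hpull Z hZ) (hpull Y hY)
  rw [(hchain Z d hd).fderiv_eq, (hchain Y c hc).fderiv_eq] at hb
  simp only [fderiv_fun_const, Pi.zero_apply, _root_.zero_apply, sub_zero] at hb
  have h1 : mfderiv (𝓡 m) 𝓘(ℝ, F) f p = fderiv ℝ F' (φ p) := by
    have := hmd.self_of_nhds.mfderiv
    rw [ModelWithCorners.range_eq_univ, fderivWithin_univ] at this
    exact this
  have h2 : VectorField.mlieBracket (𝓡 m) Y Z p =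
      VectorField.lieBracket ℝ (pull Y) (pull Z) (φ p) := by
    have h3 : ∀ w : EuclideanSpace ℝ (Fin m), (ContinuousLinearMap.id ℝ
        (EuclideanSpace ℝ (Fin m))).inverse w = w := fun w => by
      rw [ContinuousLinearMap.inverse_id]; rfl
    rw [← VectorField.mlieBracketWithin_univ, VectorField.mlieBracketWithin_apply,
      mfderiv_extChartAt_self, preimage_univ, univ_inter]
    refine (h3 _).trans ?_
    simp only [pull, ModelWithCorners.range_eq_univ]
    exact congrFun VectorField.lieBracketWithin_univ _
  rw [h1, h2]
  exact hb

end Bracket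

end

/-! ### The differential of the orbit projection -/

section

section OrbitProjection

variable {M : Type*} [TopologicalSpace M] [ChartedSpace (EuclideanSpace ℝ (Fin 4)) M]
  {k : ∀ x : M, TangentSpace (𝓡 4) x} {U : Set M}
  {M' : Type*} [TopologicalSpace M'] [ChartedSpace (EuclideanSpace ℝ (Fin 3)) M']
  {π : M → M'}

/-- The differential of `π` at `p`, with values in the model space. -/
def dpi (π : M → M') (p : M) : TangentSpace (𝓡 4) p →ₗ[ℝ] EuclideanSpace ℝ (Fin 3) :=
  (mfderiv (𝓡 4) (𝓡 3) π p).toLinearMap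

lemma IsOrbitProjection.contMDiffAt (hπ : IsOrbitProjection k U π) {p : M} (hp : p ∈ U) :
    ContMDiffAt (𝓡 4) (𝓡 3) ∞ π p := hπ.smooth.contMDiffAt (hπ.isOpen.mem_nhds hp)

lemma IsOrbitProjection.dpi_surjective (hπ : IsOrbitProjection k U π) {p : M} (hp : p ∈ U) :
    Function.Surjective (dpi π p) := hπ.submersion p hp

/-- The orbit through `p` is mapped to one point, so `π ∘ γ` has zero velocity. -/
lemma IsOrbitProjection.dpi_k (hπ : IsOrbitProjection k U π) {p : M} (hp : p ∈ U) :
    dpi π p (k p) = 0 := by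
  obtain ⟨T, γ, hT, -, hγ, him⟩ := hπ.orbits (π p)
  have hpm : p ∈ γ '' T := by rw [him]; exact ⟨hp, rfl⟩
  obtain ⟨t, ht, rfl⟩ := hpm
  have h1 := (hγ t ht).hasMFDerivAt (hT.mem_nhds ht)
  have h2 := ((hπ.contMDiffAt hp).mdifferentiableAt (by simp)).hasMFDerivAt.comp t h1
  have h3 : π ∘ γ =ᶠ[𝓝 t] fun _ => π (γ t) := by
    filter_upwards [hT.mem_nhds ht] with s hs
    have : γ s ∈ γ '' T := mem_image_of_mem _ hs
    rw [him] at this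
    exact this.2
  have h4 := hasMFDerivAt_unique h2
    ((hasMFDerivAt_const (I := 𝓘(ℝ, ℝ)) (I' := 𝓡 3) (π (γ t)) t).congr_of_eventuallyEq h3)
  have h5 := congrArg (fun l => l (1 : ℝ)) h4
  have h6 : mfderiv (𝓡 4) (𝓡 3) π (γ t) ((1 : ℝ) • k (γ t)) = 0 := h5
  rwa [one_smul] at h6

/-- The kernel contains `K` and has dimension `4 - 3 = 1`. -/
lemma IsOrbitProjection.dpi_eq_zero (hπ : IsOrbitProjection k U π) {p : M} (hp : p ∈ U)
    (hk0 : k p ≠ 0) {v : TangentSpace (𝓡 4) p} :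
    dpi π p v = 0 ↔ v ∈ Submodule.span ℝ {k p} := by
  have : FiniteDimensional ℝ (TangentSpace (𝓡 4) p) :=
    inferInstanceAs (FiniteDimensional ℝ (EuclideanSpace ℝ (Fin 4)))
  have h4 : Module.finrank ℝ (TangentSpace (𝓡 4) p) = 4 :=
    finrank_euclideanSpace_fin (𝕜 := ℝ) (n := 4)
  have h := LinearMap.finrank_range_add_finrank_ker (dpi π p)
  rw [LinearMap.range_eq_top.2 (hπ.dpi_surjective hp), finrank_top, h4,
    finrank_euclideanSpace_fin] at h
  have hle : Submodule.span ℝ {k p} ≤ LinearMap.ker (dpi π p) := by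
    rw [Submodule.span_singleton_le_iff_mem]
    exact hπ.dpi_k hp
  have heq := Submodule.eq_of_le_of_finrank_eq hle (by rw [finrank_span_singleton hk0]; omega)
  rw [heq]; rfl

lemma IsOrbitProjection.dpi_eq (hπ : IsOrbitProjection k U π) {p : M} (hp : p ∈ U)
    (hk0 : k p ≠ 0) {v w : TangentSpace (𝓡 4) p} :
    dpi π p v = dpi π p w ↔ v - w ∈ Submodule.span ℝ {k p} := by
  rw [← hπ.dpi_eq_zero hp hk0, map_sub, sub_eq_zero]

/-- In the chart at a point of `M'`, the differential of `π` along the fibre of this point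
is `dpi`. -/
lemma IsOrbitProjection.mfderiv_chart_comp [IsManifold (𝓡 3) ∞ M'] (hπ : IsOrbitProjection k U π)
    {q : M} (hq : q ∈ U) {x : M'} (hx : π q = x) (v : TangentSpace (𝓡 4) q) :
    (mfderiv (𝓡 4) 𝓘(ℝ, EuclideanSpace ℝ (Fin 3)) (fun q => extChartAt (𝓡 3) x (π q)) q v :
      EuclideanSpace ℝ (Fin 3)) = dpi π q v := by
  subst hx
  have : IsManifold (𝓡 3) 1 M' := IsManifold.of_le (n := ∞) (by simp)
  have h := mfderiv_comp q (I'' := 𝓘(ℝ, EuclideanSpace ℝ (Fin 3)))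
    (mdifferentiableAt_extChartAt (I := 𝓡 3) (mem_chart_source _ (π q)))
    ((hπ.contMDiffAt hq).mdifferentiableAt (by simp))
  rw [mfderiv_extChartAt_self] at h
  exact congrArg (fun l => l v) h

lemma IsOrbitProjection.contMDiffAt_chart_comp [IsManifold (𝓡 3) ∞ M']
    (hπ : IsOrbitProjection k U π) {p q : M} (hq : q ∈ U)
    (hq' : π q ∈ (extChartAt (𝓡 3) (π p)).source) :
    ContMDiffAt (𝓡 4) 𝓘(ℝ, EuclideanSpace ℝ (Fin 3)) ∞
      (fun q => extChartAt (𝓡 3) (π p) (π q)) q :=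
  (contMDiffAt_extChartAt' (by rwa [extChartAt_source] at hq')).comp q (hπ.contMDiffAt hq)

/-- Here the chart of `M'` is fixed while `q` leaves the fibre of its centre, where the derivative
is no longer `dpi`. Flow and bracket arguments need the statement on such an open set. -/
lemma IsOrbitProjection.mfderiv_chart_comp_k [IsManifold (𝓡 3) ∞ M'] (hπ : IsOrbitProjection k U π) {q : M} (hq : q ∈ U)
    {x : M'} (hx : π q ∈ (extChartAt (𝓡 3) x).source) :
    mfderiv (𝓡 4) 𝓘(ℝ, EuclideanSpace ℝ (Fin 3)) (fun q => extChartAt (𝓡 3) x (π q)) q (k q) =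
      0 := by
  have : IsManifold (𝓡 3) 1 M' := IsManifold.of_le (n := ∞) (by simp)
  have h := mfderiv_comp q (I'' := 𝓘(ℝ, EuclideanSpace ℝ (Fin 3)))
    (mdifferentiableAt_extChartAt (I := 𝓡 3) (by rwa [extChartAt_source] at hx))
    ((hπ.contMDiffAt hq).mdifferentiableAt (by simp))
  have h2 := congrArg (fun l => l (k q)) h
  refine h2.trans ?_
  have h3 : mfderiv (𝓡 4) (𝓡 3) π q (k q) = 0 := hπ.dpi_k hq
  rw [ContinuousLinearMap.comp_apply, h3, map_zero]

end OrbitProjection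

/-! ### Comparing screens at two points of a fibre -/

variable {M : Type*} [TopologicalSpace M] [ChartedSpace (EuclideanSpace ℝ (Fin 4)) M]
  [IsManifold (𝓡 4) ∞ M] {g : LorentzMetric M} {k : ∀ x : M, TangentSpace (𝓡 4) x}
  {J : ∀ x : M, Screen g k x →ₗ[ℝ] Screen g k x} {U : Set M}
  {M' : Type*} [TopologicalSpace M'] [ChartedSpace (EuclideanSpace ℝ (Fin 3)) M']
  {π : M → M'}

variable (g k π) in
/-- `K^⊥` and its conformal structure have the same image under `dπ` at `p` and at `q`. -/
def SameScreen (p q : M) : Prop :=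
  ∃ c : ℝ, 0 < c ∧ ∀ v ∈ Kperp g k p, ∀ w ∈ Kperp g k p, ∀ v' w' : TangentSpace (𝓡 4) q,
    dpi π q v' = dpi π p v → dpi π q w' = dpi π p w →
      v' ∈ Kperp g k q ∧ g.form q v' w' = c * g.form p v w

variable (g k J π) in
/-- The image of the `J`-pairs at `p` under `dπ`. -/
def imageJPairs (p : M) : Set (EuclideanSpace ℝ (Fin 3) × EuclideanSpace ℝ (Fin 3)) :=
  {z | ∃ a b, IsJPair g k J p a b ∧ z = (dpi π p a, dpi π p b)}

/-- The `K`-ambiguity in a pair dies under `dπ`, so what remains is the complex line of multiples of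
`dπ a + i dπ b`. -/
lemma imageJPairs_eq (hn : ∀ x, g.form x (k x) (k x) = 0) (hk0 : ∀ x, k x ≠ 0)
    (hJ : IsQuarterTurnOn g k J U) (hπ : IsOrbitProjection k U π) {p : M} (hp : p ∈ U)
    {a b : TangentSpace (𝓡 4) p} (h : IsJPair g k J p a b)
    (hak : a ∉ Submodule.span ℝ {k p}) :
    imageJPairs g k J π p = {z | ∃ s t : ℝ, z = (s • dpi π p a - t • dpi π p b,
      s • dpi π p b + t • dpi π p a)} := by
  ext z
  constructor
  · rintro ⟨c, d, hcd, rfl⟩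
    obtain ⟨s, t, r, r', rfl, rfl⟩ := h.exists_eq (hn p) (hk0 p) hJ hp hak hcd
    refine ⟨s, t, ?_⟩
    simp [hπ.dpi_k hp]
  · rintro ⟨s, t, rfl⟩
    refine ⟨s • a - t • b, s • b + t • a, ?_, by simp⟩
    have := (h.smul s).add ((h.rotate (hJ.sq p hp)).smul (-t))
    simpa [sub_eq_add_neg] using this

/-- A conformal `2 × 2` matrix, with rows `(s, t)` and `(u, w)`, is a rotation or a reflection. -/
lemma conformal_dichotomy {s t u w : ℝ} (h1 : s * u + t * w = 0)
    (h2 : u * u + w * w = s * s + t * t) : (u = -t ∧ w = s) ∨ (u = t ∧ w = -s) := by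
  -- With `z = s + it` and `ζ = u + iw`, the factors are `|ζ - iz|²` and `|ζ + iz|²`. Their product
  -- `|ζ² + z²|²` vanishes by the two hypotheses.
  have h : ((u + t) ^ 2 + (w - s) ^ 2) * ((u - t) ^ 2 + (w + s) ^ 2) = 0 := by
    have e : ((u + t) ^ 2 + (w - s) ^ 2) * ((u - t) ^ 2 + (w + s) ^ 2) =
        (u * u + w * w - (s * s + t * t)) ^ 2 + 4 * (s * u + t * w) ^ 2 := by ring
    rw [e, h1, h2]; ring
  rcases mul_eq_zero.1 h with h | h <;>
  obtain ⟨e1, e2⟩ := (add_eq_zero_iff_of_nonneg (sq_nonneg _) (sq_nonneg _)).1 h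
  · exact Or.inl ⟨by linarith [pow_eq_zero_iff (two_ne_zero) |>.1 e1],
      by linarith [pow_eq_zero_iff (two_ne_zero) |>.1 e2]⟩
  · exact Or.inr ⟨by linarith [pow_eq_zero_iff (two_ne_zero) |>.1 e1],
      by linarith [pow_eq_zero_iff (two_ne_zero) |>.1 e2]⟩

/-- Both pairs are orthogonal with equal lengths, and the two screens carry the same conformal
structure. The matrix relating them is therefore conformal: a rotation or a reflection, up to scale.
-/
lemma SameScreen.exists_coeff (hn : ∀ x, g.form x (k x) (k x) = 0) (hk0 : ∀ x, k x ≠ 0)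
    (hJ : IsQuarterTurnOn g k J U) (hπ : IsOrbitProjection k U π) {p q : M} (hp : p ∈ U)
    (hq : q ∈ U) (hpq : SameScreen g k π p q) {a b : TangentSpace (𝓡 4) p}
    (h : IsJPair g k J p a b) (hak : a ∉ Submodule.span ℝ {k p}) {a' b' : TangentSpace (𝓡 4) q}
    (h' : IsJPair g k J q a' b') :
    ∃ s t u w : ℝ, dpi π q a' = s • dpi π p a + t • dpi π p b ∧
      dpi π q b' = u • dpi π p a + w • dpi π p b ∧
      ((u = -t ∧ w = s) ∨ (u = t ∧ w = -s)) := by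
  obtain ⟨c, hc, hcon⟩ := hpq
  -- Lifts to `q` of the projected pair at `p`. They form a conformal frame of the screen at `q`, in
  -- which `a'` and `b'` are expanded modulo `k`.
  obtain ⟨α, hα⟩ := hπ.dpi_surjective hq (dpi π p a)
  obtain ⟨β, hβ⟩ := hπ.dpi_surjective hq (dpi π p b)
  have haa := form_self_pos (hn p) (hk0 p) h.1 hak
  have hbb := h.form_eq hJ hp h
  obtain ⟨hα', gαα⟩ := hcon a h.1 a h.1 α α hα hα
  obtain ⟨hβ', gββ⟩ := hcon b h.2.1 b h.2.1 β β hβ hβ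
  obtain ⟨-, gαβ⟩ := hcon a h.1 b h.2.1 α β hα hβ
  rw [h.form_orth hJ hp, mul_zero] at gαβ
  rw [hbb, ← gαα] at gββ
  have hS : 0 < g.form q α α := by rw [gαα]; positivity
  obtain ⟨r, s, t, ha'⟩ := exists_eq_of_mem_Kperp (hn q) (hk0 q) hα' hβ' gαβ hS
    (by rw [gββ]; exact hS) h'.1
  obtain ⟨r', u, w, hb'⟩ := exists_eq_of_mem_Kperp (hn q) (hk0 q) hα' hβ' gαβ hS
    (by rw [gββ]; exact hS) h'.2.1
  refine ⟨s, t, u, w, ?_, ?_, ?_⟩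
  · simp [ha', hπ.dpi_k hq, hα, hβ]
  · simp [hb', hπ.dpi_k hq, hα, hβ]
  · have gβα : g.form q β α = 0 := by rw [g.symm]; exact gαβ
    have gkα : g.form q (k q) α = 0 := hα'
    have gkβ : g.form q (k q) β = 0 := hβ'
    have gαk : g.form q α (k q) = 0 := by rw [g.symm]; exact gkα
    have gβk : g.form q β (k q) = 0 := by rw [g.symm]; exact gkβ
    have e1 := h'.form_orth hJ hq
    have e2 := h'.form_eq hJ hq h'
    rw [ha', hb'] at e1 e2
    simp [gβα, gkα, gkβ, gαk, gβk, gαβ, gββ, hn q] at e1 e2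
    have f1 : s * u + t * w = 0 := by
      have : (s * u + t * w) * g.form q α α = 0 := by linarith
      exact (mul_eq_zero.1 this).resolve_right hS.ne'
    have f2 : u * u + w * w = s * s + t * t := by
      have : (u * u + w * w - (s * s + t * t)) * g.form q α α = 0 := by linarith
      have := (mul_eq_zero.1 this).resolve_right hS.ne'
      linarith
    exact conformal_dichotomy f1 f2

end

/-! ### The projected complex structure is constant along orbits -/

section

variable {M : Type*} [TopologicalSpace M] [ChartedSpace (EuclideanSpace ℝ (Fin 4)) M]
  [IsManifold (𝓡 4) ∞ M] {g : LorentzMetric M} {k : ∀ x : M, TangentSpace (𝓡 4) x}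
  {J : ∀ x : M, Screen g k x →ₗ[ℝ] Screen g k x} {U : Set M}
  {M' : Type*} [TopologicalSpace M'] [ChartedSpace (EuclideanSpace ℝ (Fin 3)) M']
  [IsManifold (𝓡 3) ∞ M'] {π : M → M'}

/-- The values of `dpi` on a smooth field are continuous along a fibre. -/
lemma continuousAt_dpi_comp (hπ : IsOrbitProjection k U π) {γ : ℝ → M} {t₀ : ℝ}
    (hγ : ContinuousAt γ t₀) (hU : ∀ᶠ t in 𝓝 t₀, γ t ∈ U ∧ π (γ t) = π (γ t₀))
    {ξ : ∀ x : M, TangentSpace (𝓡 4) x} {V : Set M} (hV : IsOpen V) (ht₀ : γ t₀ ∈ V)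
    (hξ : SmoothFieldOn ξ V) : ContinuousAt (fun t => dpi π (γ t) (ξ (γ t))) t₀ := by
  have h1 : ContMDiffAt (𝓡 4) 𝓘(ℝ, EuclideanSpace ℝ (Fin 3)) ∞
      (fun q => (mfderiv (𝓡 4) 𝓘(ℝ, EuclideanSpace ℝ (Fin 3))
        (fun q => extChartAt (𝓡 3) (π (γ t₀)) (π q)) q (ξ q) : EuclideanSpace ℝ (Fin 3))) (γ t₀) :=
    contMDiffAt_mfderiv_apply (v := fun q => (⟨q, ξ q⟩ : TangentBundle (𝓡 4) M))
      (hπ.contMDiffAt_chart_comp hU.self_of_nhds.1 (mem_extChartAt_source _))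
      (hξ.contMDiffAt (hV.mem_nhds ht₀))
  refine (ContinuousAt.comp h1.continuousAt hγ).congr ?_
  filter_upwards [hU] with t ht
  exact hπ.mfderiv_chart_comp ht.1 ht.2 _

/-- The complex multiples of `X + iY` and of a nonzero complex multiple of it are the same. -/
lemma complexMultiples_eq {E : Type*} [AddCommGroup E] [Module ℝ E] (X Y : E) {a b : ℝ}
    (hD : a * a + b * b ≠ 0) :
    {z : E × E | ∃ s t : ℝ, z = (s • X - t • Y, s • Y + t • X)} =
      {z | ∃ s t : ℝ, z = (s • (a • X + b • Y) - t • (-b • X + a • Y),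
        s • (-b • X + a • Y) + t • (a • X + b • Y))} := by
  ext z
  constructor
  · rintro ⟨s, τ, rfl⟩
    refine ⟨(s * a - τ * b) / (a * a + b * b), (τ * a + s * b) / (a * a + b * b), ?_⟩
    have e1 : s = (s * a - τ * b) / (a * a + b * b) * a + (τ * a + s * b) / (a * a + b * b) * b := by
      rw [div_mul_eq_mul_div, div_mul_eq_mul_div, ← add_div, eq_div_iff hD]; ring
    have e2 : τ = (τ * a + s * b) / (a * a + b * b) * a - (s * a - τ * b) / (a * a + b * b) * b := by
      rw [div_mul_eq_mul_div, div_mul_eq_mul_div, ← sub_div, eq_div_iff hD]; ring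
    generalize (s * a - τ * b) / (a * a + b * b) = c at *
    generalize (τ * a + s * b) / (a * a + b * b) = d at *
    rw [e1, e2]
    ext1 <;> module
  · rintro ⟨s, τ, rfl⟩
    refine ⟨s * a + τ * b, τ * a - s * b, ?_⟩
    ext1 <;> module

/-- A reflection would reverse orientation. The determinant of the matrix relating a smooth pair at
`γ t` to its value at `γ t₀` is 1 at `t₀`, so it stays positive nearby and only the rotation case
survives. -/
lemma eventually_imageJPairs_eq (hn : ∀ x, g.form x (k x) (k x) = 0) (hk0 : ∀ x, k x ≠ 0)
    (hJ : IsQuarterTurnOn g k J U) (hπ : IsOrbitProjection k U π) {γ : ℝ → M} {t₀ : ℝ}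
    (hγ : ContinuousAt γ t₀) (hU : ∀ᶠ t in 𝓝 t₀, γ t ∈ U ∧ π (γ t) = π (γ t₀))
    (hs : ∀ᶠ t in 𝓝 t₀, SameScreen g k π (γ t₀) (γ t)) :
    ∀ᶠ t in 𝓝 t₀, imageJPairs g k J π (γ t₀) = imageJPairs g k J π (γ t) := by
  have hp := hU.self_of_nhds.1
  obtain ⟨V, ξ, η, hV, hpV, hVU, hξs, hηs, hξη⟩ := hJ.smooth _ hp
  obtain ⟨hξk, hξη₀⟩ := hξη _ hpV
  have hX := continuousAt_dpi_comp hπ hγ hU hV hpV hξs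
  have hY := continuousAt_dpi_comp hπ hγ hU hV hpV hηs
  set X := dpi π (γ t₀) (ξ (γ t₀)) with hXdef
  set Y := dpi π (γ t₀) (η (γ t₀)) with hYdef
  let L : ℝ × ℝ →ₗ[ℝ] EuclideanSpace ℝ (Fin 3) :=
    (LinearMap.fst ℝ ℝ ℝ).smulRight X + (LinearMap.snd ℝ ℝ ℝ).smulRight Y
  have hL : ∀ s t, L (s, t) = s • X + t • Y := fun s t => by simp [L]
  have hker : LinearMap.ker L = ⊥ := by
    rw [LinearMap.ker_eq_bot']
    rintro ⟨s, t⟩ hst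
    rw [hL, hXdef, hYdef, ← map_smul, ← map_smul, ← map_add, hπ.dpi_eq_zero hp (hk0 _)] at hst
    obtain ⟨r, hr⟩ := Submodule.mem_span_singleton.1 hst
    obtain ⟨rfl, rfl⟩ := IsJPair.not_mem_span (hn _) (hk0 _) hJ hp hξη₀ hξk hr.symm
    rfl
  -- Coordinates with respect to `X, Y`, extended linearly to the whole model space, so that their
  -- continuity in `t` needs no knowledge of the plane in which the projected vectors lie.
  obtain ⟨f, hf⟩ := L.exists_leftInverse_of_injective hker
  have hfL : ∀ s t, f (s • X + t • Y) = (s, t) := fun s t => by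
    rw [← hL]; exact congrArg (fun l => l (s, t)) hf
  have hfc : Continuous f := f.continuous_of_finiteDimensional
  have hfX : f X = (1, 0) := by simpa using hfL 1 0
  have hfY : f Y = (0, 1) := by simpa using hfL 0 1
  have hfXc := hfc.continuousAt.comp hX
  have hfYc := hfc.continuousAt.comp hY
  have hdet : ∀ᶠ t in 𝓝 t₀,
      0 < (f (dpi π (γ t) (ξ (γ t)))).1 * (f (dpi π (γ t) (η (γ t)))).2
        - (f (dpi π (γ t) (ξ (γ t)))).2 * (f (dpi π (γ t) (η (γ t)))).1 := by
    refine ContinuousAt.eventually_lt continuousAt_const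
      ((hfXc.fst.mul hfYc.snd).sub (hfXc.snd.mul hfYc.fst)) ?_
    change 0 < (f X).1 * (f Y).2 - (f X).2 * (f Y).1
    simp [hfX, hfY]
  filter_upwards [hdet, hU, hs, hγ.eventually_mem (hV.mem_nhds hpV)] with t ht hUt hst hVt
  obtain ⟨hξkt, hξηt⟩ := hξη _ hVt
  obtain ⟨a, b, u, w, hXt, hYt, hcase⟩ :=
    hst.exists_coeff hn hk0 hJ hπ hp hUt.1 hξη₀ hξk hξηt
  rw [← hXdef, ← hYdef] at hXt hYt
  rw [hXt, hYt, hfL, hfL] at ht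
  rw [imageJPairs_eq hn hk0 hJ hπ hp hξη₀ hξk, imageJPairs_eq hn hk0 hJ hπ hUt.1 hξηt hξkt,
    hXt, hYt, ← hXdef, ← hYdef]
  rcases hcase with ⟨hu, hw⟩ | ⟨hu, hw⟩ <;> rw [hu, hw] at ht ⊢ <;> simp only at ht
  · exact complexMultiples_eq X Y (by nlinarith)
  -- For a reflection the determinant is `-(a² + b²)`, which is not positive.
  · nlinarith [sq_nonneg a, sq_nonneg b]

/-- If `K^⊥` and its conformal structure are locally constant along the orbits, then the image of
the `J`-pairs is constant on the fibres of `π`. -/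
lemma imageJPairs_eq_of_sameScreen (hn : ∀ x, g.form x (k x) (k x) = 0) (hk0 : ∀ x, k x ≠ 0)
    (hJ : IsQuarterTurnOn g k J U) (hπ : IsOrbitProjection k U π)
    (hs : ∀ (γ : ℝ → M) (t₀ : ℝ), IsMIntegralCurveAt γ k t₀ →
      (∀ᶠ t in 𝓝 t₀, γ t ∈ U ∧ π (γ t) = π (γ t₀)) →
      ∀ᶠ t in 𝓝 t₀, SameScreen g k π (γ t₀) (γ t)) {p q : M} (hp : p ∈ U) (hq : q ∈ U)
    (hpq : π p = π q) : imageJPairs g k J π p = imageJPairs g k J π q := by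
  obtain ⟨T, γ, hT, hTc, hγ, him⟩ := hπ.orbits (π p)
  have hmem : ∀ t ∈ T, γ t ∈ U ∧ π (γ t) = π p := fun t ht => by
    have : γ t ∈ γ '' T := mem_image_of_mem _ ht
    rwa [him] at this
  have hpm : p ∈ γ '' T := by rw [him]; exact ⟨hp, rfl⟩
  have hqm : q ∈ γ '' T := by rw [him]; exact ⟨hq, hpq.symm⟩
  obtain ⟨t₁, ht₁, rfl⟩ := hpm
  obtain ⟨t₂, ht₂, rfl⟩ := hqm
  -- A symmetric and transitive relation that holds locally on the interval `T` holds between any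
  -- two of its points.
  refine hTc.isPreconnected.induction₂
    (fun s t => imageJPairs g k J π (γ s) = imageJPairs g k J π (γ t)) ?_
    (fun _ _ _ _ _ _ h h' => h.trans h') (fun _ _ _ _ h => h.symm) ht₁ ht₂
  intro t ht
  have hγt := hγ.isMIntegralCurveAt (hT.mem_nhds ht)
  have hU : ∀ᶠ s in 𝓝 t, γ s ∈ U ∧ π (γ s) = π (γ t) := by
    filter_upwards [hT.mem_nhds ht] with s hs
    exact ⟨(hmem s hs).1, (hmem s hs).2.trans (hmem t ht).2.symm⟩
  exact nhdsWithin_le_nhds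
    (eventually_imageJPairs_eq hn hk0 hJ hπ hγt.continuousAt hU (hs γ t hγt hU))

end

/-! ### Shear-freeness in terms of the flow -/

section

section IntegralCurve

variable {n : ℕ} {X : Type*} [TopologicalSpace X] [ChartedSpace (EuclideanSpace ℝ (Fin n)) X]
  {F : Type*} [NormedAddCommGroup F] [NormedSpace ℝ F]

/-- The derivative of a function along an integral curve. -/
lemma hasDerivAt_comp_integralCurve {γ : ℝ → X} {Y : ∀ x : X, TangentSpace (𝓡 n) x} {t : ℝ}
    (hγ : HasMFDerivAt 𝓘(ℝ, ℝ) (𝓡 n) γ t ((1 : ℝ →L[ℝ] ℝ).smulRight (Y (γ t)))) {f : X → F}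
    (hf : MDifferentiableAt (𝓡 n) 𝓘(ℝ, F) f (γ t)) :
    HasDerivAt (fun s => f (γ s)) (mfderiv (𝓡 n) 𝓘(ℝ, F) f (γ t) (Y (γ t)) : F) t := by
  let L : ℝ →L[ℝ] F :=
    (mfderiv (𝓡 n) 𝓘(ℝ, F) f (γ t)).comp ((1 : ℝ →L[ℝ] ℝ).smulRight (Y (γ t)))
  have h0 : HasFDerivAt (fun s => f (γ s)) L t := (hf.hasMFDerivAt.comp t hγ).hasFDerivAt
  have h := h0.hasDerivAt
  have e : (mfderiv (𝓡 n) 𝓘(ℝ, F) f (γ t)) ((1 : ℝ) • Y (γ t)) =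
      mfderiv (𝓡 n) 𝓘(ℝ, F) f (γ t) (Y (γ t)) := by rw [one_smul]
  exact h.congr_deriv e

end IntegralCurve

variable {M : Type*} [TopologicalSpace M] [ChartedSpace (EuclideanSpace ℝ (Fin 4)) M]
  [IsManifold (𝓡 4) ∞ M] {g : LorentzMetric M} {k : ∀ x : M, TangentSpace (𝓡 4) x}
  {U : Set M}
  {M' : Type*} [TopologicalSpace M'] [ChartedSpace (EuclideanSpace ℝ (Fin 3)) M']
  [IsManifold (𝓡 3) ∞ M'] {π : M → M'}

/-- A local flow of `k` preserves `π`. -/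
lemma IsLocalFlow.eventually_comp_eq (hπ : IsOrbitProjection k U π) {O : Set M} {ε : ℝ}
    {θ : ℝ × M → M} (hθ : IsLocalFlow k O ε θ) {p : M} (hpO : p ∈ O) (hp : p ∈ U) :
    ∀ᶠ t in 𝓝 (0 : ℝ), t ∈ Ioo (-ε) ε ∧ θ (t, p) ∈ U ∧
      (fun y => π (θ (t, y))) =ᶠ[𝓝 p] π := by
  have hopen : IsOpen (Ioo (-ε) ε ×ˢ O) := isOpen_Ioo.prod hθ.isOpen
  have h0 : ((0 : ℝ), p) ∈ Ioo (-ε) ε ×ˢ O := ⟨⟨by linarith [hθ.pos], hθ.pos⟩, hpO⟩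
  have hc : ContinuousAt θ (0, p) := (hθ.smooth.contMDiffAt (hopen.mem_nhds h0)).continuousAt
  have hθ0 : θ (0, p) = p := hθ.zero p hpO
  have hU : U ∩ π ⁻¹' (extChartAt (𝓡 3) (π p)).source ∈ 𝓝 (θ (0, p)) := by
    rw [hθ0]
    exact inter_mem (hπ.isOpen.mem_nhds hp)
      ((hπ.contMDiffAt hp).continuousAt (extChartAt_source_mem_nhds (I := 𝓡 3) (π p)))
  obtain ⟨A, hA, B, hB, hAB⟩ := mem_nhds_prod_iff.1 (inter_mem (hopen.mem_nhds h0) (hc hU))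
  obtain ⟨δ, hδ, hδA⟩ := Metric.mem_nhds_iff.1 hA
  have hgood : ∀ t ∈ Metric.ball (0 : ℝ) δ, ∀ y ∈ B, (t ∈ Ioo (-ε) ε ∧ y ∈ O) ∧
      θ (t, y) ∈ U ∧ π (θ (t, y)) ∈ (extChartAt (𝓡 3) (π p)).source :=
    fun t ht y hy => hAB (mk_mem_prod (hδA ht) hy)
  have hconst : ∀ t ∈ Metric.ball (0 : ℝ) δ, ∀ y ∈ B, π (θ (t, y)) = π y := by
    intro t ht y hy
    have h0δ : (0 : ℝ) ∈ Metric.ball (0 : ℝ) δ := Metric.mem_ball_self hδ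
    -- Read in one fixed chart of `M'`, the curve `s ↦ π (θ (s, y))` has velocity `dπ(k) = 0`.
    have hd : ∀ s ∈ Metric.ball (0 : ℝ) δ,
        HasDerivAt (fun s => extChartAt (𝓡 3) (π p) (π (θ (s, y)))) 0 s := by
      intro s hs
      obtain ⟨⟨hsε, hyO⟩, hsU, hsS⟩ := hgood s hs y hy
      have h1 := (hθ.integral y hyO s hsε).hasMFDerivAt (isOpen_Ioo.mem_nhds hsε)
      have h2 : MDifferentiableAt (𝓡 4) 𝓘(ℝ, EuclideanSpace ℝ (Fin 3))
          (fun q => extChartAt (𝓡 3) (π p) (π q)) (θ (s, y)) :=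
        (hπ.contMDiffAt_chart_comp hsU hsS).mdifferentiableAt (by simp)
      have h3 := hasDerivAt_comp_integralCurve h1 h2
      exact h3.congr_deriv (hπ.mfderiv_chart_comp_k hsU hsS)
    have heq := Metric.isOpen_ball.is_const_of_deriv_eq_zero
      (convex_ball (0 : ℝ) δ).isPreconnected
      (fun s hs => (hd s hs).differentiableAt.differentiableWithinAt)
      (fun s hs => (hd s hs).deriv) ht h0δ
    have := (extChartAt (𝓡 3) (π p)).injOn (hgood t ht y hy).2.2 (hgood 0 h0δ y hy).2.2 heq
    rw [this, hθ.zero y (hgood 0 h0δ y hy).1.2]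
  filter_upwards [Metric.ball_mem_nhds (0 : ℝ) hδ] with t ht
  obtain ⟨⟨h1, -⟩, h2, -⟩ := hgood t ht p (mem_of_mem_nhds hB)
  refine ⟨h1, h2, ?_⟩
  filter_upwards [hB] with y hy
  exact hconst t ht y hy

/-- By uniqueness of integral curves, `γ` is an orbit of the flow. Differentiating `π ∘ θ_t = π`
gives `dπ ∘ dθ_t = dπ`, so a vector at `γ t` with the same projection as `v` is `dθ_t v` modulo `k`,
and `k` does not contribute to products in `K^⊥`. -/
lemma FlowShearFree.sameScreen (hsf : FlowShearFree g k) (hk : SmoothFieldOn k univ)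
    (hk0 : ∀ x, k x ≠ 0) (hπ : IsOrbitProjection k U π) {γ : ℝ → M} {t₀ : ℝ}
    (hγ : IsMIntegralCurveAt γ k t₀) (hU : ∀ᶠ t in 𝓝 t₀, γ t ∈ U ∧ π (γ t) = π (γ t₀)) :
    ∀ᶠ t in 𝓝 t₀, SameScreen g k π (γ t₀) (γ t) := by
  have : IsManifold (𝓡 4) 1 M := IsManifold.of_le (n := ∞) (by simp)
  obtain ⟨hn, hflow⟩ := hsf
  set p := γ t₀ with hpdef
  have hp : p ∈ U := hU.self_of_nhds.1
  obtain ⟨O, ε, θ, hpO, hθ, hpres⟩ := hflow p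
  have hint : IsMIntegralCurveAt (fun t => θ (t, p)) k 0 :=
    (hθ.integral p hpO).isMIntegralCurveAt
      (isOpen_Ioo.mem_nhds ⟨by linarith [hθ.pos], hθ.pos⟩)
  have hγ' : IsMIntegralCurveAt (γ ∘ (· + t₀)) k 0 := by
    simpa using hγ.comp_add t₀
  have hkat : ContMDiffAt (𝓡 4) (𝓡 4).tangent 1
      (fun x => (⟨x, k x⟩ : TangentBundle (𝓡 4) M)) ((γ ∘ (· + t₀)) 0) :=
    (hk.contMDiffAt univ_mem).of_le (by simp)
  have heq : γ ∘ (· + t₀) =ᶠ[𝓝 0] fun t => θ (t, p) :=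
    isMIntegralCurveAt_eventuallyEq_of_contMDiffAt_boundaryless hkat hγ' hint
      (by simp [hθ.zero p hpO, p])
  have key : ∀ᶠ t in 𝓝 (0 : ℝ), SameScreen g k π p (γ (t + t₀)) := by
    filter_upwards [heq, hθ.eventually_comp_eq hπ hpO hp] with t ht hcomp
    obtain ⟨htε, hqU, hcomp⟩ := hcomp
    have ht' : γ (t + t₀) = θ (t, p) := ht
    rw [ht']
    obtain ⟨hperp, c, hc, hcon⟩ := hpres p hpO t htε
    have hθt : ContMDiffAt (𝓡 4) (𝓡 4) ∞ (fun y => θ (t, y)) p :=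
      (hθ.smooth.contMDiffAt ((isOpen_Ioo.prod hθ.isOpen).mem_nhds ⟨htε, hpO⟩)).comp p
        (contMDiffAt_const.prodMk contMDiffAt_id)
    have hchain := mfderiv_comp p ((hπ.contMDiffAt hqU).mdifferentiableAt (by simp))
      (hθt.mdifferentiableAt (by simp))
    have hd : ∀ v : TangentSpace (𝓡 4) p,
        dpi π (θ (t, p)) (mfderiv (𝓡 4) (𝓡 4) (fun y => θ (t, y)) p v) = dpi π p v := by
      intro v
      have h1 := congrArg (fun l => l v) hchain
      have h2 := congrArg (fun l => l v) (hcomp.mfderiv_eq (I := 𝓡 4) (I' := 𝓡 3))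
      exact h1.symm.trans h2
    have hlift : ∀ v : TangentSpace (𝓡 4) p, ∀ v' : TangentSpace (𝓡 4) (θ (t, p)),
        dpi π (θ (t, p)) v' = dpi π p v →
        ∃ r : ℝ, v' = mfderiv (𝓡 4) (𝓡 4) (fun y => θ (t, y)) p v + r • k (θ (t, p)) := by
      intro v v' h
      rw [← hd v, hπ.dpi_eq hqU (hk0 _)] at h
      obtain ⟨r, hr⟩ := Submodule.mem_span_singleton.1 h
      exact ⟨r, by rw [hr]; abel⟩
    refine ⟨c, hc, fun v hv w hw v' w' hv' hw' => ?_⟩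
    obtain ⟨r, rfl⟩ := hlift v v' hv'
    obtain ⟨s, rfl⟩ := hlift w w' hw'
    have e1 := hperp v hv
    have e2 := hperp w hw
    refine ⟨(Kperp g k _).add_mem e1 ((Kperp g k _).smul_mem r (hn _)), ?_⟩
    rw [← hcon v hv w hw]
    rw [mem_Kperp] at e1 e2
    have e1' := g.symm (θ (t, p)) _ _ ▸ e1
    simp [e1', e2, hn]
  have hten : Tendsto (fun t => t - t₀) (𝓝 t₀) (𝓝 0) := by
    have : ContinuousAt (fun t : ℝ => t - t₀) t₀ := by fun_prop
    simpa [ContinuousAt] using this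
  filter_upwards [hten.eventually key] with t ht
  simpa using ht

end

/-! ### Linear equations along orbits and lifts of constant fields -/

section

variable {M : Type*} [TopologicalSpace M] [ChartedSpace (EuclideanSpace ℝ (Fin 4)) M]
  [IsManifold (𝓡 4) ∞ M] {g : LorentzMetric M} {k : ∀ x : M, TangentSpace (𝓡 4) x}
  {J : ∀ x : M, Screen g k x →ₗ[ℝ] Screen g k x} {U : Set M}
  {M' : Type*} [TopologicalSpace M'] [ChartedSpace (EuclideanSpace ℝ (Fin 3)) M']
  [IsManifold (𝓡 3) ∞ M'] {π : M → M'}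

/-- Two solutions of the same linear differential equation, one without zeros, are proportional. -/
lemma mul_eq_mul_of_hasDerivAt {f h c : ℝ → ℝ} {t₀ δ : ℝ}
    (hf : ∀ t ∈ Metric.ball t₀ δ, HasDerivAt f (c t * f t) t)
    (hh : ∀ t ∈ Metric.ball t₀ δ, HasDerivAt h (c t * h t) t)
    (h0 : ∀ t ∈ Metric.ball t₀ δ, h t ≠ 0) {t : ℝ} (ht : t ∈ Metric.ball t₀ δ) :
    f t * h t₀ = f t₀ * h t := by
  have hδ : t₀ ∈ Metric.ball t₀ δ := Metric.mem_ball_self (Metric.nonempty_ball.1 ⟨t, ht⟩)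
  have hd : ∀ s ∈ Metric.ball t₀ δ, HasDerivAt (fun s => f s / h s) 0 s := by
    intro s hs
    refine ((hf s hs).fun_div (hh s hs) (h0 s hs)).congr_deriv ?_
    rw [div_eq_zero_iff]
    left; ring
  have heq := Metric.isOpen_ball.is_const_of_deriv_eq_zero
    (convex_ball t₀ δ).isPreconnected
    (fun s hs => (hd s hs).differentiableAt.differentiableWithinAt)
    (fun s hs => (hd s hs).deriv) ht hδ
  rwa [div_eq_div_iff (h0 t ht) (h0 t₀ hδ)] at heq

/-- Constant vector fields on the orbit space lift to smooth vector fields. -/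
lemma IsOrbitProjection.exists_lift (hπ : IsOrbitProjection k U π) {p : M} (hp : p ∈ U) :
    ∃ (V : Set M) (Y : EuclideanSpace ℝ (Fin 3) → ∀ x : M, TangentSpace (𝓡 4) x),
      IsOpen V ∧ p ∈ V ∧ (∀ q ∈ V, q ∈ U ∧ π q ∈ (extChartAt (𝓡 3) (π p)).source) ∧
      (∀ e, SmoothFieldOn (Y e) V) ∧ ∀ e, ∀ q ∈ V,
        (mfderiv (𝓡 4) 𝓘(ℝ, EuclideanSpace ℝ (Fin 3)) (fun q => extChartAt (𝓡 3) (π p) (π q)) q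
          (Y e q) : EuclideanSpace ℝ (Fin 3)) = e := by
  set F : M → EuclideanSpace ℝ (Fin 3) := fun q => extChartAt (𝓡 3) (π p) (π q)
  -- Lifts at `p` of the standard basis, extended to smooth fields `Z i`. Away from `p` their
  -- projections are only near the basis, and this is corrected by inverting `P`.
  choose r hr using fun i : Fin 3 =>
    hπ.dpi_surjective hp (EuclideanSpace.single i (1 : ℝ))
  let Z : Fin 3 → ∀ x : M, TangentSpace (𝓡 4) x := fun i =>
    FiberBundle.extend (EuclideanSpace ℝ (Fin 4)) (r i)
  choose s hs hsZ using fun i : Fin 3 => FiberBundle.exists_contMDiffOn_extend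
    (k := ∞) (𝓡 4) (EuclideanSpace ℝ (Fin 4)) (r i)
  have hbase : U ∩ π ⁻¹' (extChartAt (𝓡 3) (π p)).source ∈ 𝓝 p :=
    inter_mem (hπ.isOpen.mem_nhds hp)
      ((hπ.contMDiffAt hp).continuousAt (extChartAt_source_mem_nhds (I := 𝓡 3) (π p)))
  obtain ⟨V₀, hV₀, hV₀o, hpV₀⟩ := mem_nhds_iff.1
    (inter_mem hbase (inter_mem (hs 0) (inter_mem (hs 1) (hs 2))))
  have hZ : ∀ i, ∀ q ∈ V₀, ContMDiffAt (𝓡 4) (𝓡 4).tangent ∞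
      (fun x => (⟨x, Z i x⟩ : TangentBundle (𝓡 4) M)) q := by
    intro i q hq
    have hsub : V₀ ⊆ s i := by
      intro y hy
      have := hV₀ hy
      fin_cases i
      · exact this.2.1
      · exact this.2.2.1
      · exact this.2.2.2
    exact ((hsZ i).mono hsub).contMDiffAt (hV₀o.mem_nhds hq)
  have hF : ∀ q ∈ V₀, ContMDiffAt (𝓡 4) 𝓘(ℝ, EuclideanSpace ℝ (Fin 3)) ∞ F q := fun q hq =>
    hπ.contMDiffAt_chart_comp (hV₀ hq).1.1 (hV₀ hq).1.2
  let W : Fin 3 → M → EuclideanSpace ℝ (Fin 3) := fun i q =>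
    mfderiv (𝓡 4) 𝓘(ℝ, EuclideanSpace ℝ (Fin 3)) F q (Z i q)
  have hW : ∀ i, ∀ q ∈ V₀, ContMDiffAt (𝓡 4) 𝓘(ℝ, EuclideanSpace ℝ (Fin 3)) ∞ (W i) q :=
    fun i q hq => contMDiffAt_mfderiv_apply
      (v := fun q => (⟨q, Z i q⟩ : TangentBundle (𝓡 4) M)) (hF q hq) (hZ i q hq)
  let P : M → EuclideanSpace ℝ (Fin 3) →L[ℝ] EuclideanSpace ℝ (Fin 3) := fun q =>
    ∑ i, (EuclideanSpace.proj i : EuclideanSpace ℝ (Fin 3) →L[ℝ] ℝ).smulRight (W i q)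
  have hPapp : ∀ q e, P q e = ∑ i, e i • W i q := fun q e => by
    simp [P, _root_.sum_apply]
  have hP : ∀ q ∈ V₀, ContMDiffAt (𝓡 4)
      𝓘(ℝ, EuclideanSpace ℝ (Fin 3) →L[ℝ] EuclideanSpace ℝ (Fin 3)) ∞ P q := by
    intro q hq
    refine ContMDiffAt.sum fun i _ => ?_
    exact ((ContinuousLinearMap.smulRightL ℝ (EuclideanSpace ℝ (Fin 3))
      (EuclideanSpace ℝ (Fin 3)) (EuclideanSpace.proj i)).contMDiff.contMDiffAt).comp q (hW i q hq)
  have hPp : P p = ContinuousLinearMap.id ℝ _ := by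
    ext e : 1
    rw [hPapp]
    have : ∀ i, W i p = EuclideanSpace.single i 1 := fun i => by
      rw [← hr i, ← hπ.mfderiv_chart_comp hp rfl]
      simp only [W, Z, FiberBundle.extend_apply_self]
      rfl
    simp only [this]
    ext j
    simp [Fin.sum_univ_three]
    fin_cases j <;> simp
  -- `P` is the identity at `p` and invertibility is an open condition.
  let V : Set M := V₀ ∩ P ⁻¹' range ((↑) : (EuclideanSpace ℝ (Fin 3) ≃L[ℝ]
    EuclideanSpace ℝ (Fin 3)) → EuclideanSpace ℝ (Fin 3) →L[ℝ] EuclideanSpace ℝ (Fin 3))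
  have hVo : IsOpen V := ContinuousOn.isOpen_inter_preimage
    (fun q hq => (hP q hq).continuousAt.continuousWithinAt) hV₀o
    (ContinuousLinearEquiv.isOpen)
  let Y : EuclideanSpace ℝ (Fin 3) → ∀ x : M, TangentSpace (𝓡 4) x := fun e q =>
    ∑ i, ((P q).inverse e) i • Z i q
  refine ⟨V, Y, hVo, ⟨hpV₀, ContinuousLinearEquiv.refl ℝ _, by rw [hPp]; rfl⟩,
    fun q hq => (hV₀ hq.1).1, fun e q hq => ?_, fun e q hq => ?_⟩
  · refine ContMDiffAt.contMDiffWithinAt ?_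
    obtain ⟨L, hL⟩ := hq.2
    have hinv : ContMDiffAt (𝓡 4) 𝓘(ℝ, EuclideanSpace ℝ (Fin 3) →L[ℝ] EuclideanSpace ℝ (Fin 3)) ∞
        (fun q => (P q).inverse) q := by
      have h1 : ContDiffAt ℝ ∞ ContinuousLinearMap.inverse (P q) := by
        rw [← hL]; exact contDiffAt_map_inverse L
      exact h1.contMDiffAt.comp q (hP q hq.1)
    refine ContMDiffAt.sum_section fun i _ => ?_
    refine ContMDiffAt.smul_section ?_ (hZ i q hq.1)
    have h2 : ContDiff ℝ ∞ (fun A : EuclideanSpace ℝ (Fin 3) →L[ℝ] EuclideanSpace ℝ (Fin 3) =>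
        (A e) i) := by fun_prop
    exact h2.contMDiff.contMDiffAt.comp q hinv
  · obtain ⟨L, hL⟩ := hq.2
    have h1 : (mfderiv (𝓡 4) 𝓘(ℝ, EuclideanSpace ℝ (Fin 3)) F q (Y e q) :
        EuclideanSpace ℝ (Fin 3)) = P q ((P q).inverse e) := by
      rw [hPapp]
      refine (map_sum _ _ _).trans ?_
      refine Finset.sum_congr rfl fun i _ => ?_
      exact map_smul _ _ _
    rw [h1, ← hL, ContinuousLinearMap.inverse_equiv]
    exact L.apply_symm_apply e

end

/-! ### Shear-freeness in terms of the Lie derivative -/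

section

variable {M : Type*} [TopologicalSpace M] [ChartedSpace (EuclideanSpace ℝ (Fin 4)) M]
  [IsManifold (𝓡 4) ∞ M] {g : LorentzMetric M} {k : ∀ x : M, TangentSpace (𝓡 4) x}
  {J : ∀ x : M, Screen g k x →ₗ[ℝ] Screen g k x} {U : Set M}
  {M' : Type*} [TopologicalSpace M'] [ChartedSpace (EuclideanSpace ℝ (Fin 3)) M']
  [IsManifold (𝓡 3) ∞ M'] {π : M → M'}

/-- The derivative of `g(Y, Z)` along an integral curve of `k`. -/
lemma hasDerivAt_form_integralCurve {γ : ℝ → M} {t : ℝ}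
    (hγ : HasMFDerivAt 𝓘(ℝ, ℝ) (𝓡 4) γ t ((1 : ℝ →L[ℝ] ℝ).smulRight (k (γ t)))) {V : Set M}
    (hV : IsOpen V) (hγV : γ t ∈ V) {Y Z : ∀ x : M, TangentSpace (𝓡 4) x}
    (hY : SmoothFieldOn Y V) (hZ : SmoothFieldOn Z V) :
    HasDerivAt (fun s => g.form (γ s) (Y (γ s)) (Z (γ s)))
      (lieG g k Y Z (γ t) + g.form (γ t) (VectorField.mlieBracket (𝓡 4) k Y (γ t)) (Z (γ t))
        + g.form (γ t) (Y (γ t)) (VectorField.mlieBracket (𝓡 4) k Z (γ t))) t := by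
  have hf : ContMDiffAt (𝓡 4) 𝓘(ℝ, ℝ) ∞ (fun y => g.form y (Y y) (Z y)) (γ t) :=
    contMDiffAt_form g (hY.contMDiffAt (hV.mem_nhds hγV)) (hZ.contMDiffAt (hV.mem_nhds hγV))
  refine (hasDerivAt_comp_integralCurve hγ (hf.mdifferentiableAt (by simp))).congr_deriv ?_
  have h : ∀ a b c : ℝ, a = a - b - c + b + c := fun a b c => by ring
  exact h _ _ _

/-- For lifts `Y e` of constant fields, `g(Y e, k)` and then `g(Y e, Y e')` on `K^⊥` obey
homogeneous linear equations along `γ`. As `lam` and `φ` carry no regularity, these are not solved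
by an integrating factor: each solution is compared with a nowhere zero one. -/
lemma LieShearFree.sameScreen (hsf : LieShearFree g k) (hk : SmoothFieldOn k univ)
    (hk0 : ∀ x, k x ≠ 0) (hJ : IsQuarterTurnOn g k J U) (hπ : IsOrbitProjection k U π)
    {γ : ℝ → M} {t₀ : ℝ}
    (hγ : IsMIntegralCurveAt γ k t₀) (hU : ∀ᶠ t in 𝓝 t₀, γ t ∈ U ∧ π (γ t) = π (γ t₀)) :
    ∀ᶠ t in 𝓝 t₀, SameScreen g k π (γ t₀) (γ t) := by
  obtain ⟨hn, lam, φ, hlie⟩ := hsf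
  set p := γ t₀ with hpdef
  have hp : p ∈ U := hU.self_of_nhds.1
  obtain ⟨V, Y, hV, hpV, hVU, hYs, hYe⟩ := hπ.exists_lift hp
  have hdY : ∀ e, ∀ q ∈ V, π q = π p → dpi π q (Y e q) = e := fun e q hq hqp => by
    rw [← hπ.mfderiv_chart_comp (hVU q hq).1 hqp, hYe e q hq]
  -- `Y e` projects to a constant field and `k` to zero, so their bracket is vertical.
  have hbr : ∀ e, ∀ q ∈ V, π q = π p →
      ∃ r : ℝ, r • k q = VectorField.mlieBracket (𝓡 4) k (Y e) q := by
    intro e q hq hqp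
    rw [← Submodule.mem_span_singleton, ← hπ.dpi_eq_zero (hVU q hq).1 (hk0 q),
      ← hπ.mfderiv_chart_comp (hVU q hq).1 hqp]
    refine mfderiv_mlieBracket_eq_zero (c := 0) (d := e)
      (hπ.contMDiffAt_chart_comp (hVU q hq).1 (hVU q hq).2) (hk.contMDiffAt univ_mem)
      ((hYs e).contMDiffAt (hV.mem_nhds hq)) ?_ ?_
    · filter_upwards [hV.mem_nhds hq] with y hy
      exact hπ.mfderiv_chart_comp_k (hVU y hy).1 (hVU y hy).2
    · filter_upwards [hV.mem_nhds hq] with y hy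
      exact hYe e y hy
  have hgood : ∀ᶠ t in 𝓝 t₀, HasMFDerivAt 𝓘(ℝ, ℝ) (𝓡 4) γ t
      ((1 : ℝ →L[ℝ] ℝ).smulRight (k (γ t))) ∧ γ t ∈ V ∧ π (γ t) = π p := by
    filter_upwards [hγ, hγ.continuousAt.eventually_mem (hV.mem_nhds hpV), hU] with t h1 h2 h3
    exact ⟨h1, h2, h3.2⟩
  have hkV : SmoothFieldOn k V := hk.mono (subset_univ _)
  let u : EuclideanSpace ℝ (Fin 3) → ℝ → ℝ := fun e t => g.form (γ t) (Y e (γ t)) (k (γ t))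
  let G : EuclideanSpace ℝ (Fin 3) → EuclideanSpace ℝ (Fin 3) → ℝ → ℝ :=
    fun e e' t => g.form (γ t) (Y e (γ t)) (Y e' (γ t))
  -- The bracket term is a multiple of `g(k, k) = 0`, and the symmetric product contributes `φ(k)
  -- g(k, Y)`.
  have hu : ∀ e t, (HasMFDerivAt 𝓘(ℝ, ℝ) (𝓡 4) γ t
      ((1 : ℝ →L[ℝ] ℝ).smulRight (k (γ t))) ∧ γ t ∈ V ∧ π (γ t) = π p) →
      HasDerivAt (u e) ((lam (γ t) + φ (γ t) (k (γ t))) * u e t) t := by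
    rintro e t ⟨h1, h2, h3⟩
    refine (hasDerivAt_form_integralCurve h1 hV h2 (hYs e) hkV).congr_deriv ?_
    obtain ⟨r, hr⟩ := hbr e _ h2 h3
    rw [hlie V _ _ hV (hYs e) hkV _ h2, ← hr, VectorField.mlieBracket_self]
    simp only [u, map_smul, map_zero, hn, Pi.zero_apply, smul_apply, smul_eq_mul]
    rw [g.symm _ (k (γ t)) (Y e (γ t))]
    ring
  -- Where `Y e` and `Y e'` lie in `K^⊥`, both the `φ` terms and the vertical brackets drop out.
  have hG : ∀ e e' t, (HasMFDerivAt 𝓘(ℝ, ℝ) (𝓡 4) γ t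
      ((1 : ℝ →L[ℝ] ℝ).smulRight (k (γ t))) ∧ γ t ∈ V ∧ π (γ t) = π p) →
      u e t = 0 → u e' t = 0 → HasDerivAt (G e e') (lam (γ t) * G e e' t) t := by
    rintro e e' t ⟨h1, h2, h3⟩ hue hue'
    refine (hasDerivAt_form_integralCurve h1 hV h2 (hYs e) (hYs e')).congr_deriv ?_
    obtain ⟨r, hr⟩ := hbr e _ h2 h3
    obtain ⟨r', hr'⟩ := hbr e' _ h2 h3
    simp only [u] at hue hue'
    rw [hlie V _ _ hV (hYs e) (hYs e') _ h2, ← hr, ← hr']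
    simp only [G, map_smul, smul_apply, smul_eq_mul, hue]
    rw [g.symm _ (k (γ t)) (Y e (γ t)), g.symm _ (k (γ t)) (Y e' (γ t)), hue, hue']
    ring
  have hg₀ := hgood.self_of_nhds
  have hYp : ∀ v : TangentSpace (𝓡 4) p, ∃ r : ℝ, Y (dpi π p v) p = v + r • k p := by
    intro v
    have h : dpi π p (Y (dpi π p v) p) = dpi π p v := hdY _ p hpV rfl
    rw [hπ.dpi_eq hp (hk0 p)] at h
    obtain ⟨r, hr⟩ := Submodule.mem_span_singleton.1 h
    exact ⟨r, by rw [hr]; abel⟩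
  have hup : ∀ v : TangentSpace (𝓡 4) p, u (dpi π p v) t₀ = g.form p (k p) v := by
    intro v
    obtain ⟨r, hr⟩ := hYp v
    change g.form p (Y (dpi π p v) p) (k p) = _
    rw [hr, g.symm, map_add, map_smul, hn, smul_zero, add_zero]
  obtain ⟨v₁, hv₁⟩ := exists_form_ne_zero (g := g) (hk0 p)
  have hu₁ : u (dpi π p v₁) t₀ ≠ 0 := by rwa [hup]
  obtain ⟨V', ξ, η, -, hpV', -, -, -, hξη⟩ := hJ.smooth p hp
  obtain ⟨hξk, hξp, -⟩ := hξη p hpV'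
  have hξ0 : dpi π p (ξ p) ≠ 0 := fun h => hξk ((hπ.dpi_eq_zero hp (hk0 p)).1 h)
  obtain ⟨δ, hδ, hball⟩ := Metric.eventually_nhds_iff_ball.1
    (hgood.and ((hu _ t₀ hg₀).continuousAt.eventually_ne hu₁))
  -- Proportionality to the nonvanishing solution given by `v₁`: the lift of a vector of `K^⊥` stays
  -- in `K^⊥`.
  have hu0 : ∀ e, u e t₀ = 0 → ∀ t ∈ Metric.ball t₀ δ, u e t = 0 := by
    intro e he t ht
    have := mul_eq_mul_of_hasDerivAt (fun s hs => hu e s (hball s hs).1)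
      (fun s hs => hu (dpi π p v₁) s (hball s hs).1) (fun s hs => (hball s hs).2) ht
    rw [he, zero_mul] at this
    exact (mul_eq_zero.1 this).resolve_right hu₁
  have huξ : u (dpi π p (ξ p)) t₀ = 0 := by rw [hup]; exact hξp
  -- The lift of `ξ p` stays in `K^⊥` and off `K`, so its square length is the nowhere zero
  -- reference solution for `G`. The conformal factor is the ratio of its values.
  have hpos : ∀ t ∈ Metric.ball t₀ δ, 0 < G (dpi π p (ξ p)) (dpi π p (ξ p)) t := by
    intro t ht
    obtain ⟨-, h2, h3⟩ := (hball t ht).1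
    refine form_self_pos (hn _) (hk0 _) ?_ fun hmem => hξ0 ?_
    · rw [mem_Kperp, g.symm]; exact hu0 _ huξ t ht
    · exact (hdY _ _ h2 h3).symm.trans ((hπ.dpi_eq_zero (hVU _ h2).1 (hk0 _)).2 hmem)
  have ht₀ : t₀ ∈ Metric.ball t₀ δ := Metric.mem_ball_self hδ
  filter_upwards [Metric.ball_mem_nhds t₀ hδ] with t ht
  obtain ⟨-, hqV, hqp⟩ := (hball t ht).1
  set h := G (dpi π p (ξ p)) (dpi π p (ξ p)) with hh
  refine ⟨h t / h t₀, div_pos (hpos t ht) (hpos t₀ ht₀), fun v hv w hw v' w' hv' hw' => ?_⟩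
  have hlift : ∀ v : TangentSpace (𝓡 4) p, ∀ v' : TangentSpace (𝓡 4) (γ t),
      dpi π (γ t) v' = dpi π p v → ∃ r : ℝ, v' = Y (dpi π p v) (γ t) + r • k (γ t) := by
    intro v v' h
    have h' := h.trans (hdY (dpi π p v) _ hqV hqp).symm
    rw [hπ.dpi_eq (hVU _ hqV).1 (hk0 _)] at h'
    obtain ⟨r, hr⟩ := Submodule.mem_span_singleton.1 h'
    exact ⟨r, by rw [hr]; abel⟩
  obtain ⟨r, rfl⟩ := hlift v v' hv'
  obtain ⟨s, rfl⟩ := hlift w w' hw'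
  have huv : ∀ v ∈ Kperp g k p, ∀ s ∈ Metric.ball t₀ δ, u (dpi π p v) s = 0 := fun v hv s hs =>
    hu0 _ (by rw [hup]; exact hv) s hs
  have e1 := huv v hv t ht
  have e2 := huv w hw t ht
  simp only [u] at e1 e2
  have e1' := g.symm (γ t) _ _ ▸ e1
  have e2' := g.symm (γ t) _ _ ▸ e2
  have hprop := mul_eq_mul_of_hasDerivAt (f := G (dpi π p v) (dpi π p w)) (h := h)
    (fun s hs => hG _ _ s (hball s hs).1 (huv v hv s hs) (huv w hw s hs))
    (fun s hs => hG _ _ s (hball s hs).1 (huv _ hξp s hs) (huv _ hξp s hs))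
    (fun s hs => (hpos s hs).ne') ht
  have hGp : G (dpi π p v) (dpi π p w) t₀ = g.form p v w := by
    obtain ⟨a, ha⟩ := hYp v
    obtain ⟨b, hb⟩ := hYp w
    change g.form p (Y (dpi π p v) p) (Y (dpi π p w) p) = _
    rw [mem_Kperp] at hv hw
    have hv' := g.symm p _ _ ▸ hv
    rw [ha, hb]
    simp [hv', hw, hn]
  refine ⟨?_, ?_⟩
  · rw [mem_Kperp, map_add, map_smul, hn, smul_zero, add_zero]
    exact e1'
  · rw [div_mul_eq_mul_div, eq_div_iff (hpos t₀ ht₀).ne', ← hGp, mul_comm (h t), ← hprop]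
    congr 1
    simp [G, e1, e2', hn]

end

/-! ### Alternating forms and their descent -/

section

section LinearAlgebra

variable {V W : Type*} [AddCommGroup V] [Module ℂ V] [AddCommGroup W] [Module ℂ W]

lemma wedge_self (α β : V →ₗ[ℂ] ℂ) (v : V) : wedge α β v v = 0 := by
  simp [wedge, mul_comm]

lemma neg_of_alternating {Ψ : V →ₗ[ℂ] V →ₗ[ℂ] ℂ} (hΨ : ∀ v, Ψ v v = 0) (u v : V) :
    Ψ u v = -Ψ v u := by
  have h := hΨ (u + v)
  simp only [map_add, LinearMap.add_apply, hΨ, zero_add, add_zero] at h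
  exact eq_neg_of_add_eq_zero_right h

/-- The alternating forms that kill the annihilator of `α ∧ β` are the multiples of `α ∧ β`. -/
lemma mul_wedge_eq {α β : V →ₗ[ℂ] ℂ} {Ψ : V →ₗ[ℂ] V →ₗ[ℂ] ℂ} (hΨ : ∀ v, Ψ v v = 0)
    (hker : ∀ v, wedge α β v = 0 → Ψ v = 0) {u w : V} (huw : wedge α β u w ≠ 0) (x y : V) :
    Ψ x y = Ψ u w / wedge α β u w * wedge α β x y := by
  -- Cramer's rule: `a` and `b` are chosen so that `α` and `β` vanish on the remainder.
  have hdec : ∀ x : V, ∃ a b : ℂ, ∃ z : V, wedge α β z = 0 ∧ x = a • u + b • w + z := by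
    intro x
    set D := wedge α β u w with hD
    have hD' : D = α u * β w - β u * α w := by simp [hD, wedge]
    set a := (α x * β w - β x * α w) / D with ha
    set b := (α u * β x - β u * α x) / D with hb
    have ea : a * D = α x * β w - β x * α w := div_mul_cancel₀ _ huw
    have eb : b * D = α u * β x - β u * α x := div_mul_cancel₀ _ huw
    refine ⟨a, b, x - (a • u + b • w), ?_, by abel⟩
    have h1 : α (x - (a • u + b • w)) = 0 := by
      rw [← mul_eq_zero_iff_right huw]
      simp only [map_sub, map_add, map_smul, smul_eq_mul]
      linear_combination (-α u) * ea - α w * eb + α x * hD'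
    have h2 : β (x - (a • u + b • w)) = 0 := by
      rw [← mul_eq_zero_iff_right huw]
      simp only [map_sub, map_add, map_smul, smul_eq_mul]
      linear_combination (-β u) * ea - β w * eb + β x * hD'
    ext v
    simp [wedge, h1, h2]
  -- Such a form is determined by its value on `(u, w)`. This applies to `Ψ` and to `α ∧ β` itself.
  have key : ∀ Φ : V →ₗ[ℂ] V →ₗ[ℂ] ℂ, (∀ v, Φ v v = 0) →
      (∀ v, wedge α β v = 0 → Φ v = 0) → ∀ (a b a' b' : ℂ) (z z' : V), wedge α β z = 0 →
      wedge α β z' = 0 → Φ (a • u + b • w + z) (a' • u + b' • w + z') =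
        (a * b' - b * a') * Φ u w := by
    intro Φ hΦ hk a b a' b' z z' hz hz'
    have h1 : ∀ v, Φ v z' = 0 := fun v => by
      rw [neg_of_alternating hΦ, hk z' hz']; simp
    simp only [map_add, map_smul, LinearMap.add_apply, LinearMap.smul_apply, hk z hz, h1, hΦ,
      neg_of_alternating hΦ w u, smul_eq_mul, LinearMap.zero_apply]
    ring
  obtain ⟨a, b, z, hz, rfl⟩ := hdec x
  obtain ⟨a', b', z', hz', rfl⟩ := hdec y
  rw [key Ψ hΨ hker a b a' b' z z' hz hz', key _ (wedge_self α β) (fun _ h => h) a b a' b' z z' hz hz']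
  field_simp

/-- An alternating form that kills the kernel of a surjective map descends. -/
lemma exists_descent {f : V →ₗ[ℂ] W} (hf : Function.Surjective f) {F : V →ₗ[ℂ] V →ₗ[ℂ] ℂ}
    (hF : ∀ v, F v v = 0) (hker : ∀ z, f z = 0 → F z = 0) :
    ∃ Ω : W →ₗ[ℂ] W →ₗ[ℂ] ℂ, ∀ u v, F u v = Ω (f u) (f v) := by
  obtain ⟨s, hs⟩ := f.exists_rightInverse_of_surjective (LinearMap.range_eq_top.2 hf)
  have hfs : ∀ w, f (s w) = w := fun w => congrArg (fun l => l w) hs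
  have h1 : ∀ u v, F u v = F (s (f u)) v := fun u v => by
    have := hker (u - s (f u)) (by rw [map_sub, hfs, sub_self])
    rw [map_sub, sub_eq_zero] at this
    rw [this]
  refine ⟨F.compl₁₂ s s, fun u v => ?_⟩
  rw [LinearMap.compl₁₂_apply, h1, neg_of_alternating hF, h1, neg_of_alternating hF, neg_neg]

lemma descent_unique {f : V →ₗ[ℂ] W} (hf : Function.Surjective f) {Ω Ψ : W →ₗ[ℂ] W →ₗ[ℂ] ℂ}
    (h : ∀ u v, Ω (f u) (f v) = Ψ (f u) (f v)) : Ω = Ψ := by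
  refine LinearMap.ext₂ fun a b => ?_
  obtain ⟨u, rfl⟩ := hf a
  obtain ⟨v, rfl⟩ := hf b
  exact h u v

end LinearAlgebra

section ModelVectors

variable {m : ℕ} {X : Type*} [TopologicalSpace X] [ChartedSpace (EuclideanSpace ℝ (Fin m)) X]

/-- The complex tangent vector at `x` with components `A + i B` in the model space. -/
def modelCvec (x : X) (A B : EuclideanSpace ℝ (Fin m)) : CT m x := cvec (x := x) A B

variable {x : X} {A B C D : EuclideanSpace ℝ (Fin m)}

lemma exists_modelCvec (z : CT m x) : ∃ A B : EuclideanSpace ℝ (Fin m), z = modelCvec x A B :=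
  exists_cvec z

lemma modelCvec_eq_zero : modelCvec x A B = 0 ↔ A = 0 ∧ B = 0 :=
  cvec_eq_zero (x := x) (a := A) (b := B)

lemma mem_span_modelCvec : modelCvec x C D ∈ Submodule.span ℂ {modelCvec x A B} ↔
    ∃ s t : ℝ, C = s • A - t • B ∧ D = s • B + t • A :=
  mem_span_cvec (x := x) (a := A) (b := B) (c := C) (d := D)

lemma mem_conjSubspace_modelCvec {S : Submodule ℂ (CT m x)} :
    modelCvec x A B ∈ conjSubspace S ↔ modelCvec x A (-B) ∈ S :=
  mem_conjSubspace (x := x) (a := A) (b := B)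

/-- Because `i · conj (B + iA) = A + iB`. -/
lemma conjSubspace_span_modelCvec :
    conjSubspace (Submodule.span ℂ {modelCvec x B A}) = Submodule.span ℂ {modelCvec x A B} := by
  ext z
  obtain ⟨C, D, rfl⟩ := exists_modelCvec z
  rw [mem_conjSubspace_modelCvec, mem_span_modelCvec, mem_span_modelCvec]
  constructor
  · rintro ⟨s, t, h1, h2⟩
    refine ⟨-t, -s, by rw [h1]; module, ?_⟩
    rw [← neg_neg D, h2]; module
  · rintro ⟨s, t, h1, h2⟩
    exact ⟨-t, -s, by rw [h1]; module, by rw [h2]; module⟩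

end ModelVectors

/-! ### The CR structure on the orbit space -/

variable {M : Type*} [TopologicalSpace M] [ChartedSpace (EuclideanSpace ℝ (Fin 4)) M]
  [IsManifold (𝓡 4) ∞ M] {g : LorentzMetric M} {k : ∀ x : M, TangentSpace (𝓡 4) x}
  {J : ∀ x : M, Screen g k x →ₗ[ℝ] Screen g k x} {U : Set M}
  {M' : Type*} [TopologicalSpace M'] [ChartedSpace (EuclideanSpace ℝ (Fin 3)) M']
  [IsManifold (𝓡 3) ∞ M'] {π : M → M'}

variable (g k J U π) in
/-- The conjugate of the image of `N` in the orbit space. -/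
def crBundle (x : M') : Submodule ℂ (CT 3 x) :=
  Submodule.span ℂ {z | ∃ p ∈ U, π p = x ∧ ∃ a b, IsJPair g k J p a b ∧
    z = modelCvec x (dpi π p b) (dpi π p a)}

/-- The invariance `hc` lets a single point of the fibre supply the generator. It is `dπ b + i dπ a
= i · conj (dπ a + i dπ b)`, a form that avoids minus signs. -/
lemma crBundle_eq_span (hn : ∀ x, g.form x (k x) (k x) = 0) (hk0 : ∀ x, k x ≠ 0)
    (hJ : IsQuarterTurnOn g k J U) (hπ : IsOrbitProjection k U π)
    (hc : ∀ p ∈ U, ∀ q ∈ U, π p = π q → imageJPairs g k J π p = imageJPairs g k J π q)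
    {p : M} (hp : p ∈ U) {x : M'} (hx : π p = x) {a b : TangentSpace (𝓡 4) p}
    (h : IsJPair g k J p a b) (hak : a ∉ Submodule.span ℝ {k p}) :
    crBundle g k J U π x = Submodule.span ℂ {modelCvec x (dpi π p b) (dpi π p a)} := by
  apply le_antisymm
  · rw [crBundle, Submodule.span_le]
    rintro _ ⟨q, hq, hqx, c, d, hcd, rfl⟩
    have hmem : (dpi π q c, dpi π q d) ∈ imageJPairs g k J π q := ⟨c, d, hcd, rfl⟩
    rw [← hc p hp q hq (hx.trans hqx.symm), imageJPairs_eq hn hk0 hJ hπ hp h hak] at hmem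
    obtain ⟨s, t, hst⟩ := hmem
    obtain ⟨h1, h2⟩ := Prod.mk.inj hst
    -- Conjugation turns the factor `s + it` into `s - it`.
    have e1 : s • dpi π p b + t • dpi π p a = s • dpi π p b - (-t) • dpi π p a := by module
    have e2 : s • dpi π p a - t • dpi π p b = s • dpi π p a + (-t) • dpi π p b := by module
    exact mem_span_modelCvec.2 ⟨s, -t, h2.trans e1, h1.trans e2⟩
  · rw [Submodule.span_singleton_le_iff_mem]
    exact Submodule.subset_span ⟨p, hp, hx, a, b, h, rfl⟩

lemma push_cvec (p : M) (a b : TangentSpace (𝓡 4) p) :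
    push π p (cvec a b) = modelCvec (π p) (dpi π p a) (dpi π p b) := by
  simp only [push, cvec, map_add, LinearMap.baseChange_tmul]
  rfl

lemma map_push_bundleN (hn : ∀ x, g.form x (k x) (k x) = 0) (hk0 : ∀ x, k x ≠ 0)
    (hJ : IsQuarterTurnOn g k J U) (hπ : IsOrbitProjection k U π)
    (hc : ∀ p ∈ U, ∀ q ∈ U, π p = π q → imageJPairs g k J π p = imageJPairs g k J π q)
    {p : M} (hp : p ∈ U) :
    (bundleN g k J p).map (push π p) = conjSubspace (crBundle g k J U π (π p)) := by
  obtain ⟨V, ξ, η, -, hpV, -, -, -, hξη⟩ := hJ.smooth p hp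
  obtain ⟨hξk, h⟩ := hξη p hpV
  rw [crBundle_eq_span hn hk0 hJ hπ hc hp rfl h hξk, conjSubspace_span_modelCvec,
    bundleN_eq_span (hn p) (hk0 p) hJ hp h hξk, Submodule.map_span, image_pair, push_cvec,
    push_cvec, hπ.dpi_k hp, map_zero]
  refine le_antisymm (Submodule.span_le.2 ?_) (Submodule.span_mono (by simp))
  rintro z (rfl | rfl)
  · exact Submodule.mem_span_singleton_self _
  · rw [modelCvec_eq_zero.2 ⟨rfl, rfl⟩]
    exact Submodule.zero_mem _

lemma dpi_linearIndependent (hn : ∀ x, g.form x (k x) (k x) = 0) (hk0 : ∀ x, k x ≠ 0)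
    (hJ : IsQuarterTurnOn g k J U) (hπ : IsOrbitProjection k U π)
    {p : M} (hp : p ∈ U) {a b : TangentSpace (𝓡 4) p}
    (h : IsJPair g k J p a b) (hak : a ∉ Submodule.span ℝ {k p}) {s t : ℝ}
    (hst : s • dpi π p a + t • dpi π p b = 0) : s = 0 ∧ t = 0 := by
  rw [← map_smul, ← map_smul, ← map_add, hπ.dpi_eq_zero hp (hk0 p)] at hst
  obtain ⟨r, hr⟩ := Submodule.mem_span_singleton.1 hst
  exact h.not_mem_span (hn p) (hk0 p) hJ hp hak hr.symm

lemma tangentBundle_mk_congr {m : ℕ} {X : Type*} [TopologicalSpace X]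
    [ChartedSpace (EuclideanSpace ℝ (Fin m)) X] {x y : X} (h : x = y)
    (v : EuclideanSpace ℝ (Fin m)) :
    (⟨x, v⟩ : TangentBundle (𝓡 m) X) = ⟨y, v⟩ := by subst h; rfl

/-- This is the tangent map of `π` applied to `ξ ∘ σ`; its base point `π (σ z)` is identified with
`z`. -/
lemma smoothFieldOn_dpi_comp (hπ : IsOrbitProjection k U π) {V : Set M} (hV : IsOpen V)
    (hVU : V ⊆ U) {W : Set M'} (hW : IsOpen W) {σ : M' → M}
    (hσ : ContMDiffOn (𝓡 3) (𝓡 4) ∞ σ W) (hσV : MapsTo σ W V) (hσπ : ∀ x ∈ W, π (σ x) = x)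
    {ξ : ∀ x : M, TangentSpace (𝓡 4) x} (hξ : SmoothFieldOn ξ V) :
    SmoothFieldOn (m := 3) (fun y : M' => dpi π (σ y) (ξ (σ y))) W := by
  intro y hy
  refine ContMDiffAt.contMDiffWithinAt ?_
  have h1 : ContMDiffAt (𝓡 3) (𝓡 4).tangent ∞
      (fun y => (⟨σ y, ξ (σ y)⟩ : TangentBundle (𝓡 4) M)) y :=
    (hξ.contMDiffAt (hV.mem_nhds (hσV hy))).comp y (hσ.contMDiffAt (hW.mem_nhds hy))
  refine (contMDiffAt_tangentMap_comp (hπ.contMDiffAt (hVU (hσV hy))) h1).congr_of_eventuallyEq ?_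
  filter_upwards [hW.mem_nhds hy] with z hz
  exact (tangentBundle_mk_congr (hσπ z hz) (dpi π (σ z) (ξ (σ z)))).symm

lemma isCRStructure_crBundle (hn : ∀ x, g.form x (k x) (k x) = 0) (hk0 : ∀ x, k x ≠ 0)
    (hJ : IsQuarterTurnOn g k J U) (hπ : IsOrbitProjection k U π)
    (hc : ∀ p ∈ U, ∀ q ∈ U, π p = π q → imageJPairs g k J π p = imageJPairs g k J π q) :
    IsCRStructure (crBundle g k J U π) := by
  have hsurj : ∀ x : M', ∃ p ∈ U, π p = x := fun x => by
    have : x ∈ π '' U := by rw [hπ.surjective]; trivial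
    exact this
  refine ⟨fun x => ?_, fun x => ?_, fun x => ?_⟩ <;> obtain ⟨p, hp, hx⟩ := hsurj x <;>
    obtain ⟨V, ξ, η, hV, hpV, hVU, hξs, hηs, hξη⟩ := hJ.smooth p hp <;>
    obtain ⟨hξk, h⟩ := hξη p hpV
  · rw [crBundle_eq_span hn hk0 hJ hπ hc hp hx h hξk, finrank_span_singleton]
    rw [Ne, modelCvec_eq_zero]
    rintro ⟨-, h0⟩
    exact hξk ((hπ.dpi_eq_zero hp (hk0 p)).1 h0)
  · obtain ⟨W, σ, hW, hpW, hσ, hσV, hσπ, -⟩ := exists_local_section hV (hπ.smooth.mono hVU) hpV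
      (hπ.submersion p hp)
    refine ⟨W, _, _, hW, hx ▸ hpW, smoothFieldOn_dpi_comp hπ hV hVU hW hσ hσV hσπ hηs,
      smoothFieldOn_dpi_comp hπ hV hVU hW hσ hσV hσπ hξs, fun y hy => ?_⟩
    obtain ⟨hξk, h⟩ := hξη _ (hσV hy)
    exact crBundle_eq_span hn hk0 hJ hπ hc (hVU (hσV hy)) (hσπ y hy) h hξk
  · rw [crBundle_eq_span hn hk0 hJ hπ hc hp hx h hξk, conjSubspace_span_modelCvec, eq_bot_iff]
    rintro z ⟨h1, h2⟩
    obtain ⟨c, d, rfl⟩ := exists_modelCvec z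
    obtain ⟨s, t, e1, e2⟩ := mem_span_modelCvec.1 h1
    obtain ⟨s', t', e3, e4⟩ := mem_span_modelCvec.1 h2
    have f1 : (-t - s') • dpi π p (ξ p) + (s + t') • dpi π p (η p) = 0 := by
      have := e1.symm.trans e3
      rw [← sub_eq_zero] at this
      rw [← this]
      module
    have f2 : (s - t') • dpi π p (ξ p) + (t - s') • dpi π p (η p) = 0 := by
      have := e2.symm.trans e4
      rw [← sub_eq_zero] at this
      rw [← this]
      module
    obtain ⟨k1, k2⟩ := dpi_linearIndependent hn hk0 hJ hπ hp h hξk f1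
    obtain ⟨k3, k4⟩ := dpi_linearIndependent hn hk0 hJ hπ hp h hξk f2
    have hs : s = 0 := by linarith
    have ht : t = 0 := by linarith
    rw [Submodule.mem_bot, modelCvec_eq_zero, e1, e2, hs, ht]
    simp

end

/-! ### The form `g(n) ∧ g(k)` and its pull-back by a section -/

section

variable {M : Type*} [TopologicalSpace M] [ChartedSpace (EuclideanSpace ℝ (Fin 4)) M]
  [IsManifold (𝓡 4) ∞ M] {g : LorentzMetric M} {k : ∀ x : M, TangentSpace (𝓡 4) x}
  {J : ∀ x : M, Screen g k x →ₗ[ℝ] Screen g k x} {U : Set M}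
  {M' : Type*} [TopologicalSpace M'] [ChartedSpace (EuclideanSpace ℝ (Fin 3)) M']
  [IsManifold (𝓡 3) ∞ M'] {π : M → M'}

section FormF

lemma formF_self {x : M} (n v : CT 4 x) : formF g k x n v v = 0 := wedge_self _ _ v

lemma formF_cvec {x : M} (a b v w : TangentSpace (𝓡 4) x) :
    formF g k x (cvec a b) (cvec v 0) (cvec w 0) =
      ((g.form x a v * g.form x (k x) w - g.form x (k x) v * g.form x a w : ℝ) : ℂ) +
        ((g.form x b v * g.form x (k x) w - g.form x (k x) v * g.form x b w : ℝ) : ℂ) *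
          Complex.I := by
  rw [formF_apply, gC_cvec, gC_cvec, gC_cvec, gC_cvec]
  apply Complex.ext <;> simp

lemma formF_smul {x : M} (c : ℂ) (n u v : CT 4 x) :
    formF g k x (c • n) u v = c * formF g k x n u v := by
  simp only [formF_apply, map_smul, LinearMap.smul_apply, smul_eq_mul]
  ring

/-- As `g(k, a) = 0`, the real part is `g(a, a) g(k, w)`. These values serve as denominators later.
-/
lemma formF_ne_zero {x : M} (hn : g.form x (k x) (k x) = 0) (hk0 : k x ≠ 0)
    {a b w : TangentSpace (𝓡 4) x} (ha : a ∈ Kperp g k x) (hak : a ∉ Submodule.span ℝ {k x})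
    (hw : g.form x (k x) w ≠ 0) : formF g k x (cvec a b) (cvec a 0) (cvec w 0) ≠ 0 := by
  have haa := form_self_pos hn hk0 ha hak
  rw [mem_Kperp] at ha
  intro h
  have := congrArg Complex.re ((formF_cvec a b a w).symm.trans h)
  simp [ha, haa.ne', hw] at this

/-- The form `g(n) ∧ g(k)` only depends on its arguments modulo `k`. -/
lemma formF_congr {x : M} (hn : g.form x (k x) (k x) = 0) {a b v v' w w' : TangentSpace (𝓡 4) x}
    (ha : a ∈ Kperp g k x) (hb : b ∈ Kperp g k x) (hv : v - v' ∈ Submodule.span ℝ {k x})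
    (hw : w - w' ∈ Submodule.span ℝ {k x}) :
    formF g k x (cvec a b) (cvec v 0) (cvec w 0) =
      formF g k x (cvec a b) (cvec v' 0) (cvec w' 0) := by
  obtain ⟨r, hr⟩ := Submodule.mem_span_singleton.1 hv
  obtain ⟨s, hs⟩ := Submodule.mem_span_singleton.1 hw
  obtain rfl : v = v' + r • k x := by rw [hr]; abel
  obtain rfl : w = w' + s • k x := by rw [hs]; abel
  rw [mem_Kperp, g.symm] at ha hb
  simp [formF_cvec, ha, hb, hn]

variable {EZ : Type*} [NormedAddCommGroup EZ] [NormedSpace ℝ EZ]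
  {HZ : Type*} [TopologicalSpace HZ] {IZ : ModelWithCorners ℝ EZ HZ}
  {Z : Type*} [TopologicalSpace Z] [ChartedSpace HZ Z]

lemma contMDiffAt_formF {c : Z → M} {a b v w : ∀ z, TangentSpace (𝓡 4) (c z)} {z : Z}
    (hk : ContMDiffAt IZ (𝓡 4).tangent ∞ (fun z => (⟨c z, k (c z)⟩ : TangentBundle (𝓡 4) M)) z)
    (ha : ContMDiffAt IZ (𝓡 4).tangent ∞ (fun z => (⟨c z, a z⟩ : TangentBundle (𝓡 4) M)) z)
    (hb : ContMDiffAt IZ (𝓡 4).tangent ∞ (fun z => (⟨c z, b z⟩ : TangentBundle (𝓡 4) M)) z)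
    (hv : ContMDiffAt IZ (𝓡 4).tangent ∞ (fun z => (⟨c z, v z⟩ : TangentBundle (𝓡 4) M)) z)
    (hw : ContMDiffAt IZ (𝓡 4).tangent ∞ (fun z => (⟨c z, w z⟩ : TangentBundle (𝓡 4) M)) z) :
    ContMDiffAt IZ 𝓘(ℝ, ℂ) ∞
      (fun z => formF g k (c z) (cvec (a z) (b z)) (cvec (v z) 0) (cvec (w z) 0)) z := by
  have hF : ContDiff ℝ ∞ (fun t : (((ℝ × ℝ) × ℝ) × ℝ) × (ℝ × ℝ) =>
      ((t.1.1.1.1 * t.1.1.1.2 - t.1.1.2 * t.1.2 : ℝ) : ℂ) +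
        ((t.2.1 * t.1.1.1.2 - t.1.1.2 * t.2.2 : ℝ) : ℂ) * Complex.I) := by
    have h1 : ContDiff ℝ ∞ (fun t : (((ℝ × ℝ) × ℝ) × ℝ) × (ℝ × ℝ) =>
      t.1.1.1.1 * t.1.1.1.2 - t.1.1.2 * t.1.2) := by fun_prop
    have h2 : ContDiff ℝ ∞ (fun t : (((ℝ × ℝ) × ℝ) × ℝ) × (ℝ × ℝ) =>
      t.2.1 * t.1.1.1.2 - t.1.1.2 * t.2.2) := by fun_prop
    exact (Complex.ofRealCLM.contDiff.comp h1).add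
      ((Complex.ofRealCLM.contDiff.comp h2).mul contDiff_const)
  have h := hF.contMDiff.contMDiffAt.comp z
    (((((contMDiffAt_form g ha hv).prodMk_space (contMDiffAt_form g hk hw)).prodMk_space
      (contMDiffAt_form g hk hv)).prodMk_space (contMDiffAt_form g ha hw)).prodMk_space
      ((contMDiffAt_form g hb hv).prodMk_space (contMDiffAt_form g hb hw)))
  refine h.congr_of_eventuallyEq (Eventually.of_forall fun z => ?_)
  exact formF_cvec _ _ _ _

end FormF

/-- The pull-back by `σ` of a complex 2-form at `σ x`. -/
def pullbackForm (σ : M' → M) (x : M') (F : CT 4 (σ x) →ₗ[ℂ] CT 4 (σ x) →ₗ[ℂ] ℂ) :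
    CT 3 x →ₗ[ℂ] CT 3 x →ₗ[ℂ] ℂ :=
  F.compl₁₂ ((mfderiv (𝓡 3) (𝓡 4) σ x).toLinearMap.baseChange ℂ)
    ((mfderiv (𝓡 3) (𝓡 4) σ x).toLinearMap.baseChange ℂ)

lemma pullbackForm_cvec (σ : M' → M) (x : M') (F : CT 4 (σ x) →ₗ[ℂ] CT 4 (σ x) →ₗ[ℂ] ℂ)
    (A B C D : EuclideanSpace ℝ (Fin 3)) :
    pullbackForm σ x F (modelCvec x A B) (modelCvec x C D) =
      F (cvec (mfderiv (𝓡 3) (𝓡 4) σ x A) (mfderiv (𝓡 3) (𝓡 4) σ x B))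
        (cvec (mfderiv (𝓡 3) (𝓡 4) σ x C) (mfderiv (𝓡 3) (𝓡 4) σ x D)) := by
  simp only [pullbackForm, modelCvec, cvec, map_add]
  rfl

lemma dpi_mfderiv_section (hπ : IsOrbitProjection k U π) {W : Set M'} (hW : IsOpen W)
    {σ : M' → M} (hσ : ContMDiffOn (𝓡 3) (𝓡 4) ∞ σ W) (hσU : MapsTo σ W U)
    (hσπ : ∀ x ∈ W, π (σ x) = x) {x : M'} (hx : x ∈ W) (A : EuclideanSpace ℝ (Fin 3)) :
    dpi π (σ x) (mfderiv (𝓡 3) (𝓡 4) σ x A) = A := by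
  have h1 := ((hπ.contMDiffAt (hσU hx)).mdifferentiableAt (by simp)).hasMFDerivAt.comp x
    ((hσ.contMDiffAt (hW.mem_nhds hx)).mdifferentiableAt (by simp)).hasMFDerivAt
  have h2 : π ∘ σ =ᶠ[𝓝 x] id := by
    filter_upwards [hW.mem_nhds hx] with y hy
    exact hσπ y hy
  have h3 := hasMFDerivAt_unique h1 ((hasMFDerivAt_id x).congr_of_eventuallyEq h2)
  exact congrArg (fun l => l A) h3

/-- The pull-back of `g(n) ∧ g(k)` by a section of `π` belongs to the canonical bundle. -/
lemma isCanonical_pullbackForm (hn : ∀ x, g.form x (k x) (k x) = 0) (hk0 : ∀ x, k x ≠ 0)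
    (hJ : IsQuarterTurnOn g k J U) (hπ : IsOrbitProjection k U π)
    (hc : ∀ p ∈ U, ∀ q ∈ U, π p = π q → imageJPairs g k J π p = imageJPairs g k J π q)
    {W : Set M'} (hW : IsOpen W)
    {σ : M' → M} (hσ : ContMDiffOn (𝓡 3) (𝓡 4) ∞ σ W) (hσU : MapsTo σ W U)
    (hσπ : ∀ x ∈ W, π (σ x) = x) {x : M'} (hx : x ∈ W) {a b : TangentSpace (𝓡 4) (σ x)}
    (h : IsJPair g k J (σ x) a b) (hak : a ∉ Submodule.span ℝ {k (σ x)}) :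
    IsCanonical (crBundle g k J U π) x (pullbackForm σ x (formF g k (σ x) (cvec a b))) := by
  refine ⟨fun v => formF_self _ _, fun z hz => ?_⟩
  rw [crBundle_eq_span hn hk0 hJ hπ hc (hσU hx) (hσπ x hx) h hak,
    conjSubspace_span_modelCvec] at hz
  obtain ⟨A, B, rfl⟩ := exists_modelCvec z
  obtain ⟨s, t, e1, e2⟩ := mem_span_modelCvec.1 hz
  -- `dσ` is a right inverse of `dπ`, so `dσ A` and `dσ B` agree modulo `K` with a complex multiple
  -- of the given pair.
  have hpair : IsJPair g k J (σ x) (mfderiv (𝓡 3) (𝓡 4) σ x A) (mfderiv (𝓡 3) (𝓡 4) σ x B) := by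
    have h' : IsJPair g k J (σ x) (s • a - t • b) (s • b + t • a) := by
      have := (h.smul s).add ((h.rotate (hJ.sq _ (hσU hx))).smul (-t))
      simpa [sub_eq_add_neg] using this
    refine h'.of_sub_mem_span (hn _) ?_ ?_
    · rw [← hπ.dpi_eq (hσU hx) (hk0 _)]
      refine (dpi_mfderiv_section hπ hW hσ hσU hσπ hx A).trans ?_
      rw [e1, map_sub, map_smul, map_smul]
    · rw [← hπ.dpi_eq (hσU hx) (hk0 _)]
      refine (dpi_mfderiv_section hπ hW hσ hσU hσπ hx B).trans ?_
      rw [e2, map_add, map_smul, map_smul]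
  have hF := (mem_bundleN_iff (hn _) (hk0 _) hJ (hσU hx) h hak _).1
    ((mem_bundleN (hJ.sq _ (hσU hx))).2 hpair)
  refine LinearMap.ext fun y => ?_
  obtain ⟨C, D, rfl⟩ := exists_modelCvec y
  rw [pullbackForm_cvec, hF]
  rfl

lemma pullbackForm_dpi (hn : ∀ x, g.form x (k x) (k x) = 0) (hk0 : ∀ x, k x ≠ 0)
    (hπ : IsOrbitProjection k U π) {W : Set M'} (hW : IsOpen W)
    {σ : M' → M} (hσ : ContMDiffOn (𝓡 3) (𝓡 4) ∞ σ W) (hσU : MapsTo σ W U)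
    (hσπ : ∀ x ∈ W, π (σ x) = x) {x : M'} (hx : x ∈ W) {a b : TangentSpace (𝓡 4) (σ x)}
    (ha : a ∈ Kperp g k (σ x)) (hb : b ∈ Kperp g k (σ x)) (v w : TangentSpace (𝓡 4) (σ x)) :
    pullbackForm σ x (formF g k (σ x) (cvec a b)) (modelCvec x (dpi π (σ x) v) 0)
      (modelCvec x (dpi π (σ x) w) 0) =
      formF g k (σ x) (cvec a b) (cvec v 0) (cvec w 0) := by
  have h0 : mfderiv (𝓡 3) (𝓡 4) σ x (0 : EuclideanSpace ℝ (Fin 3)) = 0 := map_zero _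
  rw [pullbackForm_cvec, h0]
  refine formF_congr (hn _) ha hb ?_ ?_
  · rw [← hπ.dpi_eq (hσU hx) (hk0 _)]
    exact dpi_mfderiv_section hπ hW hσ hσU hσπ hx _
  · rw [← hπ.dpi_eq (hσU hx) (hk0 _)]
    exact dpi_mfderiv_section hπ hW hσ hσU hσπ hx _

end

/-! ### Descent and normalization of `g(n) ∧ g(k)` -/

section

variable {M : Type*} [TopologicalSpace M] [ChartedSpace (EuclideanSpace ℝ (Fin 4)) M]
  [IsManifold (𝓡 4) ∞ M] {g : LorentzMetric M} {k : ∀ x : M, TangentSpace (𝓡 4) x}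
  {J : ∀ x : M, Screen g k x →ₗ[ℝ] Screen g k x} {U : Set M}
  {M' : Type*} [TopologicalSpace M'] [ChartedSpace (EuclideanSpace ℝ (Fin 3)) M']
  [IsManifold (𝓡 3) ∞ M'] {π : M → M'}

lemma push_surjective (hπ : IsOrbitProjection k U π) {p : M} (hp : p ∈ U) :
    Function.Surjective (push π p) := by
  intro z
  obtain ⟨A, B, rfl⟩ := exists_modelCvec z
  obtain ⟨a, rfl⟩ := hπ.dpi_surjective hp A
  obtain ⟨b, rfl⟩ := hπ.dpi_surjective hp B
  exact ⟨cvec a b, push_cvec p a b⟩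

lemma mem_bundleN_of_push_eq_zero (hn : ∀ x, g.form x (k x) (k x) = 0) (hk0 : ∀ x, k x ≠ 0)
    (hJ : IsQuarterTurnOn g k J U) (hπ : IsOrbitProjection k U π) {p : M} (hp : p ∈ U)
    {a b : TangentSpace (𝓡 4) p} (h : IsJPair g k J p a b) {z : CT 4 p} (hz : push π p z = 0) :
    z ∈ bundleN g k J p := by
  obtain ⟨c, d, rfl⟩ := exists_cvec z
  rw [push_cvec, modelCvec_eq_zero, hπ.dpi_eq_zero hp (hk0 p), hπ.dpi_eq_zero hp (hk0 p)] at hz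
  -- `h.smul 0` is the zero pair; `c` and `d` differ from it by elements of `K`.
  refine (mem_bundleN (hJ.sq p hp)).2 ((h.smul 0).of_sub_mem_span (hn p) ?_ ?_)
  · simpa using hz.1
  · simpa using hz.2

/-- The form `g(n) ∧ g(k)` descends to a unique form, which is canonical and not zero. -/
lemma exists_descent_formF (hn : ∀ x, g.form x (k x) (k x) = 0) (hk0 : ∀ x, k x ≠ 0)
    (hJ : IsQuarterTurnOn g k J U) (hπ : IsOrbitProjection k U π)
    (hc : ∀ p ∈ U, ∀ q ∈ U, π p = π q → imageJPairs g k J π p = imageJPairs g k J π q)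
    {p : M} (hp : p ∈ U) {a b : TangentSpace (𝓡 4) p}
    (h : IsJPair g k J p a b) (hak : a ∉ Submodule.span ℝ {k p}) :
    ∃ Ω : CT 3 (π p) →ₗ[ℂ] CT 3 (π p) →ₗ[ℂ] ℂ,
      (∀ Ψ : CT 3 (π p) →ₗ[ℂ] CT 3 (π p) →ₗ[ℂ] ℂ,
        (∀ u v, formF g k p (cvec a b) u v = Ψ (push π p u) (push π p v)) ↔ Ψ = Ω) ∧
      IsCanonical (crBundle g k J U π) (π p) Ω ∧ Ω ≠ 0 := by
  have hs := push_surjective hπ hp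
  have hN := mem_bundleN_iff (hn p) (hk0 p) hJ hp h hak
  obtain ⟨Ω, hΩ⟩ := exists_descent hs (formF_self (g := g) (k := k) (cvec a b)) fun z hz =>
    (hN z).1 (mem_bundleN_of_push_eq_zero hn hk0 hJ hπ hp h hz)
  refine ⟨Ω, fun Ψ => ⟨fun hΨ => descent_unique hs fun u v => ?_, fun e => e ▸ hΩ⟩,
    ⟨fun v => ?_, fun z hz => ?_⟩, fun h0 => ?_⟩
  · rw [← hΨ, hΩ]
  · obtain ⟨u, rfl⟩ := hs v
    rw [← hΩ, formF_self]
  · rw [← map_push_bundleN hn hk0 hJ hπ hc hp] at hz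
    obtain ⟨u, hu, rfl⟩ := hz
    refine LinearMap.ext fun v => ?_
    obtain ⟨v, rfl⟩ := hs v
    rw [← hΩ, (hN u).1 hu]
    rfl
  · obtain ⟨w, hw⟩ := exists_form_ne_zero (g := g) (hk0 p)
    refine formF_ne_zero (b := b) (hn p) (hk0 p) h.1 hak hw ?_
    rw [hΩ, h0]
    rfl

/-- The pull-back of an element of the canonical bundle is a multiple of `g(n) ∧ g(k)`. -/
lemma IsCanonical.push_eq (hn : ∀ x, g.form x (k x) (k x) = 0) (hk0 : ∀ x, k x ≠ 0)
    (hJ : IsQuarterTurnOn g k J U) (hπ : IsOrbitProjection k U π)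
    (hc : ∀ p ∈ U, ∀ q ∈ U, π p = π q → imageJPairs g k J π p = imageJPairs g k J π q)
    {p : M} (hp : p ∈ U) {a b : TangentSpace (𝓡 4) p}
    (h : IsJPair g k J p a b) (hak : a ∉ Submodule.span ℝ {k p})
    {Ω : CT 3 (π p) →ₗ[ℂ] CT 3 (π p) →ₗ[ℂ] ℂ} (hΩ : IsCanonical (crBundle g k J U π) (π p) Ω)
    {w : TangentSpace (𝓡 4) p} (hw : g.form p (k p) w ≠ 0) (u v : CT 4 p) :
    Ω (push π p u) (push π p v) =
      Ω (modelCvec (π p) (dpi π p a) 0) (modelCvec (π p) (dpi π p w) 0) /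
        formF g k p (cvec a b) (cvec a 0) (cvec w 0) * formF g k p (cvec a b) u v := by
  have hF := formF_ne_zero (b := b) (hn p) (hk0 p) h.1 hak hw
  have key := mul_wedge_eq (Ψ := Ω.compl₁₂ (push π p) (push π p)) (fun v => hΩ.1 _)
    (fun z hz => ?_) hF u v
  · rw [LinearMap.compl₁₂_apply, LinearMap.compl₁₂_apply, push_cvec, push_cvec, map_zero] at key
    exact key
  · have hz' := Submodule.mem_map_of_mem (f := push π p)
      ((mem_bundleN_iff (hn p) (hk0 p) hJ hp h hak z).2 hz)
    rw [map_push_bundleN hn hk0 hJ hπ hc hp] at hz'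
    refine LinearMap.ext fun y => ?_
    rw [LinearMap.compl₁₂_apply, hΩ.2 _ hz']
    rfl

lemma apply_modelCvec_congr (Ω : ∀ x : M', CT 3 x →ₗ[ℂ] CT 3 x →ₗ[ℂ] ℂ) {x y : M'} (h : x = y)
    (A B C D : EuclideanSpace ℝ (Fin 3)) :
    Ω x (modelCvec x A B) (modelCvec x C D) = Ω y (modelCvec y A B) (modelCvec y C D) := by
  subst h; rfl

/-- The pull-back of `g(n) ∧ g(k)` by a section, evaluated on a smooth family of vectors. -/
lemma contMDiffAt_pullbackForm {EZ : Type*} [NormedAddCommGroup EZ] [NormedSpace ℝ EZ]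
    {HZ : Type*} [TopologicalSpace HZ] {IZ : ModelWithCorners ℝ EZ HZ}
    {Z : Type*} [TopologicalSpace Z] [ChartedSpace HZ Z] {σ : M' → M}
    {ξ η : ∀ x : M, TangentSpace (𝓡 4) x} {V : Set M} (hV : IsOpen V)
    (hk : SmoothFieldOn k univ) (hξ : SmoothFieldOn ξ V) (hη : SmoothFieldOn η V)
    {v w : Z → TangentBundle (𝓡 3) M'} {z : Z} (hvw : ∀ z, (v z).proj = (w z).proj)
    (hσ : ContMDiffAt (𝓡 3) (𝓡 4) ∞ σ (v z).proj) (hσV : σ (v z).proj ∈ V)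
    (hv : ContMDiffAt IZ (𝓡 3).tangent ∞ v z) (hw : ContMDiffAt IZ (𝓡 3).tangent ∞ w z) :
    ContMDiffAt IZ 𝓘(ℝ, ℂ) ∞ (fun z => pullbackForm σ (v z).proj
      (formF g k (σ (v z).proj) (cvec (ξ (σ (v z).proj)) (η (σ (v z).proj))))
      (modelCvec (v z).proj (v z).2 0) (modelCvec (v z).proj (w z).2 0)) z := by
  have hb : ContMDiffAt IZ (𝓡 4) ∞ (fun z => σ (v z).proj) z :=
    hσ.comp z ((Bundle.contMDiff_proj (TangentSpace (𝓡 3) (M := M'))).contMDiffAt.comp z hv)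
  have hw' : ContMDiffAt IZ (𝓡 4).tangent ∞ (fun z => (⟨σ (v z).proj,
      mfderiv (𝓡 3) (𝓡 4) σ (v z).proj (w z).2⟩ : TangentBundle (𝓡 4) M)) z := by
    refine (contMDiffAt_tangentMap_comp (f := σ) (by rwa [← hvw]) hw).congr_of_eventuallyEq
      (Eventually.of_forall fun z => ?_)
    have : ∀ x y (h : x = y) (A : EuclideanSpace ℝ (Fin 3)),
        (⟨σ x, mfderiv (𝓡 3) (𝓡 4) σ x A⟩ : TangentBundle (𝓡 4) M) =
          ⟨σ y, mfderiv (𝓡 3) (𝓡 4) σ y A⟩ := by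
      rintro x _ rfl A; rfl
    exact this _ _ (hvw z) (w z).2
  refine (contMDiffAt_formF (g := g) (k := k) (c := fun z => σ (v z).proj)
    (a := fun z => ξ (σ (v z).proj)) (b := fun z => η (σ (v z).proj))
    (v := fun z => mfderiv (𝓡 3) (𝓡 4) σ (v z).proj (v z).2)
    (w := fun z => mfderiv (𝓡 3) (𝓡 4) σ (v z).proj (w z).2)
    ((hk.contMDiffAt univ_mem).comp z hb)
    ((hξ.contMDiffAt (hV.mem_nhds hσV)).comp z hb) ((hη.contMDiffAt (hV.mem_nhds hσV)).comp z hb)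
    (contMDiffAt_tangentMap_comp hσ hv) hw').congr_of_eventuallyEq
    (Eventually.of_forall fun z => ?_)
  have h0 : mfderiv (𝓡 3) (𝓡 4) σ (v z).proj (0 : EuclideanSpace ℝ (Fin 3)) = 0 := map_zero _
  simp only
  erw [pullbackForm_cvec, h0]

/-- After a normalization along the orbits, `g(n) ∧ g(k)` descends to a section of the canonical
bundle. -/
lemma exists_normalization (hk : SmoothFieldOn k univ)
    (hn : ∀ x, g.form x (k x) (k x) = 0) (hk0 : ∀ x, k x ≠ 0)
    (hJ : IsQuarterTurnOn g k J U) (hπ : IsOrbitProjection k U π)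
    (hc : ∀ p ∈ U, ∀ q ∈ U, π p = π q → imageJPairs g k J π p = imageJPairs g k J π q)
    {V : Set M} {ξ η : ∀ x : M, TangentSpace (𝓡 4) x} (hV : IsOpen V) (hVU : V ⊆ U)
    (hξη : IsAdaptedOn g k J ξ η V) {W : Set M'} {σ : M' → M} (hW : IsOpen W)
    (hσ : ContMDiffOn (𝓡 3) (𝓡 4) ∞ σ W) (hσV : MapsTo σ W V) (hσπ : ∀ x ∈ W, π (σ x) = x) :
    ∃ (h : M → ℂ) (F' : ∀ x : M', CT 3 x →ₗ[ℂ] CT 3 x →ₗ[ℂ] ℂ),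
      ContMDiffOn (𝓡 4) 𝓘(ℝ, ℂ) ∞ h (V ∩ π ⁻¹' W) ∧
      (∀ p ∈ V ∩ π ⁻¹' W, h p ≠ 0) ∧ (∀ x ∈ W, h (σ x) = 1) ∧
      (∀ p ∈ V ∩ π ⁻¹' W, ∀ u v : CT 4 p,
        formF g k p (h p • cvec (ξ p) (η p)) u v = F' (π p) (push π p u) (push π p v)) ∧
      IsCanonicalSectionOn (crBundle g k J U π) W F' ∧ ∀ x ∈ W, F' x ≠ 0 := by
  obtain ⟨hξs, hηs, hpair⟩ := hξη
  have hσU : MapsTo σ W U := fun x hx => hVU (hσV hx)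
  let F' : ∀ x : M', CT 3 x →ₗ[ℂ] CT 3 x →ₗ[ℂ] ℂ := fun x =>
    pullbackForm σ x (formF g k (σ x) (cvec (ξ (σ x)) (η (σ x))))
  have hF'c : ∀ x ∈ W, IsCanonical (crBundle g k J U π) x (F' x) := fun x hx =>
    isCanonical_pullbackForm hn hk0 hJ hπ hc hW hσ hσU hσπ hx (hpair _ (hσV hx)).2
      (hpair _ (hσV hx)).1
  have hF'd : ∀ x ∈ W, ∀ v w : TangentSpace (𝓡 4) (σ x),
      F' x (modelCvec x (dpi π (σ x) v) 0) (modelCvec x (dpi π (σ x) w) 0) =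
        formF g k (σ x) (cvec (ξ (σ x)) (η (σ x))) (cvec v 0) (cvec w 0) := fun x hx =>
    pullbackForm_dpi hn hk0 hπ hW hσ hσU hσπ hx (hpair _ (hσV hx)).2.1 (hpair _ (hσV hx)).2.2.1
  have hF'0 : ∀ x ∈ W, F' x ≠ 0 := by
    intro x hx h0
    obtain ⟨w, hw⟩ := exists_form_ne_zero (g := g) (hk0 (σ x))
    refine formF_ne_zero (b := η (σ x)) (hn _) (hk0 _) (hpair _ (hσV hx)).2.1 (hpair _ (hσV hx)).1
      hw ?_
    rw [← hF'd x hx, h0]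
    rfl
  choose w hw using fun p : M => exists_form_ne_zero (g := g) (hk0 p)
  -- The ratio of `π^* F'` to `F`, measured on `(ξ, w)`, where the denominator cannot vanish.
  let h : M → ℂ := fun p => F' (π p) (modelCvec (π p) (dpi π p (ξ p)) 0)
    (modelCvec (π p) (dpi π p (w p)) 0) /
      formF g k p (cvec (ξ p) (η p)) (cvec (ξ p) 0) (cvec (w p) 0)
  have hpush : ∀ p ∈ V ∩ π ⁻¹' W, ∀ w : TangentSpace (𝓡 4) p, g.form p (k p) w ≠ 0 →
      ∀ u v : CT 4 p, F' (π p) (push π p u) (push π p v) =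
      F' (π p) (modelCvec (π p) (dpi π p (ξ p)) 0) (modelCvec (π p) (dpi π p w) 0) /
        formF g k p (cvec (ξ p) (η p)) (cvec (ξ p) 0) (cvec w 0) *
          formF g k p (cvec (ξ p) (η p)) u v := fun p hp w hw =>
    (hF'c _ hp.2).push_eq hn hk0 hJ hπ hc (hVU hp.1) (hpair p hp.1).2 (hpair p hp.1).1 hw
  -- The vectors `w p` are chosen without continuity. The ratio does not depend on this choice, so
  -- near each point a smooth field can replace them.
  have hh : ∀ p ∈ V ∩ π ⁻¹' W, ∀ w : TangentSpace (𝓡 4) p, g.form p (k p) w ≠ 0 →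
      h p = F' (π p) (modelCvec (π p) (dpi π p (ξ p)) 0) (modelCvec (π p) (dpi π p w) 0) /
        formF g k p (cvec (ξ p) (η p)) (cvec (ξ p) 0) (cvec w 0) := by
    intro p hp w' hw'
    have h1 := hpush p hp (w p) (hw p) (cvec (ξ p) 0) (cvec w' 0)
    rw [push_cvec, push_cvec, map_zero] at h1
    rw [eq_div_iff (formF_ne_zero (hn p) (hk0 p) (hpair p hp.1).2.1 (hpair p hp.1).1 hw')]
    exact h1.symm
  have hopen : IsOpen (V ∩ π ⁻¹' W) := (hπ.smooth.continuousOn.mono hVU).isOpen_inter_preimage hV hW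
  refine ⟨h, F', fun p hp => ContMDiffAt.contMDiffWithinAt ?_, fun p hp h0 => ?_, fun x hx => ?_,
    fun p hp u v => ?_, ⟨hF'c, fun O Y Z hO hOW hY hZ y hy => ContMDiffAt.contMDiffWithinAt ?_⟩,
    hF'0⟩
  · let w' : ∀ x : M, TangentSpace (𝓡 4) x :=
      FiberBundle.extend (EuclideanSpace ℝ (Fin 4)) (w p)
    have hw'p : w' p = w p := FiberBundle.extend_apply_self _ _
    obtain ⟨s, hs, hsw⟩ := FiberBundle.exists_contMDiffOn_extend
      (k := ∞) (𝓡 4) (EuclideanSpace ℝ (Fin 4)) (w p)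
    have hw's : ContMDiffAt (𝓡 4) (𝓡 4).tangent ∞
        (fun x => (⟨x, w' x⟩ : TangentBundle (𝓡 4) M)) p := hsw.contMDiffAt hs
    have hξp := hξs.contMDiffAt (hV.mem_nhds hp.1)
    have hηp := hηs.contMDiffAt (hV.mem_nhds hp.1)
    have hkp := hk.contMDiffAt (univ_mem (f := 𝓝 p))
    have hgw := contMDiffAt_form g hkp hw's
    have hne : ∀ᶠ q in 𝓝 p, g.form q (k q) (w' q) ≠ 0 :=
      hgw.continuousAt.eventually_ne (by rw [hw'p]; exact hw p)
    have hden := contMDiffAt_formF (k := k) (g := g) (c := fun q => q) hkp hξp hηp hξp hw's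
    have hden0 : formF g k p (cvec (ξ p) (η p)) (cvec (ξ p) 0) (cvec (w' p) 0) ≠ 0 :=
      formF_ne_zero (hn p) (hk0 p) (hpair p hp.1).2.1 (hpair p hp.1).1 hne.self_of_nhds
    have hπp := hπ.contMDiffAt (hVU hp.1)
    have hnum := contMDiffAt_pullbackForm (g := g) (σ := σ) hV hk hξs hηs
      (v := fun q => tangentMap (𝓡 4) (𝓡 3) π ⟨q, ξ q⟩)
      (w := fun q => tangentMap (𝓡 4) (𝓡 3) π ⟨q, w' q⟩) (z := p) (fun _ => rfl)
      (hσ.contMDiffAt (hW.mem_nhds hp.2)) (hσV hp.2)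
      (contMDiffAt_tangentMap_comp hπp hξp) (contMDiffAt_tangentMap_comp hπp hw's)
    have hinv := ((contDiffAt_inv ℝ hden0 (n := ∞)).contMDiffAt).comp p hden
    have hmul : ContDiff ℝ ∞ (fun t : ℂ × ℂ => t.1 * t.2) := contDiff_mul
    refine (hmul.contMDiff.contMDiffAt.comp p (hnum.prodMk_space hinv)).congr_of_eventuallyEq ?_
    filter_upwards [hne, hopen.mem_nhds hp] with q hq hqV
    rw [hh q hqV _ hq, div_eq_mul_inv]
    rfl
  · refine hF'0 _ hp.2 (descent_unique (push_surjective hπ (hVU hp.1)) fun u v => ?_)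
    rw [hpush p hp (w p) (hw p)]
    change h p * _ = _
    rw [h0, zero_mul]
    rfl
  -- At `σ x` numerator and denominator agree, because `dπ ∘ dσ = id` and `F` ignores `k`.
  · have h1 := apply_modelCvec_congr F' (hσπ x hx) (dpi π (σ x) (ξ (σ x))) 0
      (dpi π (σ x) (w (σ x))) 0
    change F' (π (σ x)) _ _ / _ = 1
    rw [h1, hF'd x hx]
    exact div_self (formF_ne_zero (hn _) (hk0 _) (hpair _ (hσV hx)).2.1 (hpair _ (hσV hx)).1
      (hw _))
  · rw [formF_smul, hpush p hp (w p) (hw p)]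
  · exact contMDiffAt_pullbackForm (g := g) (σ := σ) hV hk hξs hηs
      (v := fun y => (⟨y, Y y⟩ : TangentBundle (𝓡 3) M'))
      (w := fun y => (⟨y, Z y⟩ : TangentBundle (𝓡 3) M')) (z := y) (fun _ => rfl)
      (hσ.contMDiffAt (hW.mem_nhds (hOW hy))) (hσV (hOW hy))
      (hY.contMDiffAt (hO.mem_nhds hy)) (hZ.contMDiffAt (hO.mem_nhds hy))

end

end NullCongruence

end

/-! ### The main theorem -/

theorem mainTheorem4
    {M : Type*} [TopologicalSpace M] [T2Space M] [ChartedSpace (EuclideanSpace ℝ (Fin 4)) M]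
    [IsManifold (𝓡 4) ∞ M]
    {M' : Type*} [TopologicalSpace M'] [T2Space M'] [ChartedSpace (EuclideanSpace ℝ (Fin 3)) M']
    [IsManifold (𝓡 3) ∞ M']
    (g : LorentzMetric M) (k : ∀ x : M, TangentSpace (𝓡 4) x)
    (hk : SmoothFieldOn k Set.univ) (hk0 : ∀ x, k x ≠ 0)
    (hsf : FlowShearFree g k ∨ LieShearFree g k)
    (U : Set M) (π : M → M') (hπ : IsOrbitProjection k U π)
    (J : ∀ x : M, Screen g k x →ₗ[ℝ] Screen g k x) (hJ : IsQuarterTurnOn g k J U) :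
    -- `N` is a totally null bundle of complex planes
    (∀ p ∈ U, Module.finrank ℂ (bundleN g k J p) = 2 ∧
      ∀ u ∈ bundleN g k J p, ∀ v ∈ bundleN g k J p, gC g p u v = 0) ∧
    ∃ B : ∀ x : M', Submodule ℂ (CT 3 x),
      -- `π_* N = conj B`, and `B` is a CR structure
      (∀ p ∈ U, (bundleN g k J p).map (push π p) = conjSubspace (B (π p))) ∧
      IsCRStructure B ∧
      -- near every point there are `n = ξ + iη` as below and a local section of `π`
      (∀ p ∈ U, ∃ (V : Set M) (ξ η : ∀ x : M, TangentSpace (𝓡 4) x) (W : Set M') (σ : M' → M),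
        IsOpen V ∧ p ∈ V ∧ V ⊆ U ∧ IsAdaptedOn g k J ξ η V ∧
        IsOpen W ∧ π p ∈ W ∧ ContMDiffOn (𝓡 3) (𝓡 4) ∞ σ W ∧ Set.MapsTo σ W V ∧
        (∀ x ∈ W, π (σ x) = x) ∧ σ (π p) = p) ∧
      ∀ (V : Set M) (ξ η : ∀ x : M, TangentSpace (𝓡 4) x), IsOpen V → V ⊆ U →
        IsAdaptedOn g k J ξ η V →
        -- the annihilator of `F = g(n) ∧ g(k)` is `N`
        (∀ p ∈ V, ∀ v : CT 4 p,
          v ∈ bundleN g k J p ↔ formF g k p (cvec (ξ p) (η p)) v = 0) ∧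
        -- at each point, `F` descends to a unique form, which is canonical and not zero
        (∀ p ∈ V, ∃ Ω : CT 3 (π p) →ₗ[ℂ] CT 3 (π p) →ₗ[ℂ] ℂ,
          (∀ Ψ : CT 3 (π p) →ₗ[ℂ] CT 3 (π p) →ₗ[ℂ] ℂ,
            (∀ u v, formF g k p (cvec (ξ p) (η p)) u v = Ψ (push π p u) (push π p v)) ↔
              Ψ = Ω) ∧
          IsCanonical B (π p) Ω ∧ Ω ≠ 0) ∧
        -- with `n` normalized along the orbits, `F` descends to a nowhere zero section
        ∀ (W : Set M') (σ : M' → M), IsOpen W → ContMDiffOn (𝓡 3) (𝓡 4) ∞ σ W →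
          Set.MapsTo σ W V → (∀ x ∈ W, π (σ x) = x) →
          ∃ (h : M → ℂ) (F' : ∀ x : M', CT 3 x →ₗ[ℂ] CT 3 x →ₗ[ℂ] ℂ),
            ContMDiffOn (𝓡 4) 𝓘(ℝ, ℂ) ∞ h (V ∩ π ⁻¹' W) ∧
            (∀ p ∈ V ∩ π ⁻¹' W, h p ≠ 0) ∧ (∀ x ∈ W, h (σ x) = 1) ∧
            (∀ p ∈ V ∩ π ⁻¹' W, ∀ u v : CT 4 p,
              formF g k p (h p • cvec (ξ p) (η p)) u v = F' (π p) (push π p u) (push π p v)) ∧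
            IsCanonicalSectionOn B W F' ∧ ∀ x ∈ W, F' x ≠ 0 := by

  have hn : ∀ x, g.form x (k x) (k x) = 0 := hsf.elim (fun h => h.1) (fun h => h.1)
  have hc : ∀ p ∈ U, ∀ q ∈ U, π p = π q → imageJPairs g k J π p = imageJPairs g k J π q :=
    fun p hp q hq => imageJPairs_eq_of_sameScreen hn hk0 hJ hπ
      (fun γ t₀ hγ hU => hsf.elim (fun h => h.sameScreen hk hk0 hπ hγ hU)
        (fun h => h.sameScreen hk hk0 hJ hπ hγ hU)) hp hq
  refine ⟨fun p hp => ?_, crBundle g k J U π, fun p hp => map_push_bundleN hn hk0 hJ hπ hc hp,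
    isCRStructure_crBundle hn hk0 hJ hπ hc, fun p hp => ?_, fun V ξ η hV hVU hξη =>
    ⟨fun p hp => ?_, fun p hp => ?_, fun W σ hW hσ hσV hσπ =>
      exists_normalization hk hn hk0 hJ hπ hc hV hVU hξη hW hσ hσV hσπ⟩⟩
  · obtain ⟨V, ξ, η, -, hpV, -, -, -, hξη⟩ := hJ.smooth p hp
    obtain ⟨hξk, h⟩ := hξη p hpV
    exact ⟨finrank_bundleN (hn p) (hk0 p) hJ hp h hξk, fun u hu v hv =>
      gC_eq_zero_of_mem_bundleN hJ hp hu hv⟩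
  · obtain ⟨V, ξ, η, hV, hpV, hVU, hξη⟩ := hJ.smooth p hp
    obtain ⟨W, σ, hW, hpW, hσ, hσV, hσπ, hσp⟩ := exists_local_section hV (hπ.smooth.mono hVU) hpV
      (hπ.submersion p hp)
    exact ⟨V, ξ, η, W, σ, hV, hpV, hVU, hξη, hW, hpW, hσ, hσV, hσπ, hσp⟩
  · exact mem_bundleN_iff (hn p) (hk0 p) hJ (hVU hp) (hξη.2.2 p hp).2 (hξη.2.2 p hp).1
  · exact exists_descent_formF hn hk0 hJ hπ hc (hVU hp) (hξη.2.2 p hp).2 (hξη.2.2 p hp).1
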